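/- **Definitions.** *Groups.* A *string group generated by involutions* (sggi) of rank $n\ge 0$ is a group $G$ together with an ordered list $g_0,\dots,g_{n-1}$ of elements of order exactly $2$ (not necessarily distinct) that generate $G$ and satisfy $(g_jg_k)^2=1$ whenever $|j-k|>1$. It is a *string C-group* if moreover $$\langle g_k : k\in I\rangle\cap\langle g_k : k\in J\rangle=\langle g_k : k\in I\cap J\rangle\qquad\text{for all } I,J\subseteq\{0,\dots,n-1\}.$$ An sggi $G'=\langle g_0',\dots,g_{n-1}'\rangle$ *covers* an sggi $G=\langle g_0,\dots,g_{n-1}\rangle$ of the same rank if there is a surjective homomorphism $G'\to G$ with $g_i'\mapsto g_i$ for all $i$. *Polytopes.* An *abstract $n$-polytope* ($n\ge -1$) is a partially ordered set $\mathcal P$, whose elements are called faces, with the following properties. (A) It has a least and a greatest face and a strictly monotone rank function with values in $\{-1,0,\dots,n\}$, where the least face has rank $-1$, the greatest face has rank $n$, and the rank increases by exactly $1$ when passing from a face to one that covers it in the partial order (so every maximal chain, or *flag*, has exactly one face of each rank $-1,0,\dots,n$). (B) Whenever $F<G$ have ranks $j-1$ and $j+1$, there are exactly two faces $H$ with $F<H<G$.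 (C) For all $F\le G$, the section $G/F=\{H: F\le H\le G\}$ is flag-connected: any two of its flags are joined by a finite sequence of flags of $G/F$ in which consecutive flags differ in exactly one face. Two flags are *$j$-adjacent* if they differ in exactly their faces of rank $j$. A face of rank $k$ is called a $k$-face, and a $k$-face $G$ is regarded as the poset $\{H : H\le G\}$. Isomorphisms are isomorphisms of posets. $\mathcal P$ is *regular* if its automorphism group is transitive on its flags. An $n$-polytope $\mathcal R$ *covers* an $n$-polytope $\mathcal Q$ if there is an order-preserving and rank-preserving map $\mathcal R\to\mathcal Q$ that takes any two $j$-adjacent flags of $\mathcal R$ to two $j$-adjacent flags of $\mathcal Q$, for every $j$. **Theorem 3.3.** (a) Every finite sggi is covered by a finite string C-group of the same rank. (b) Every finite abstract $n$-polytope $\mathcal Q$ is covered by a finite regular $n$-polytope $\mathcal R$. If, for some $k$, all $k$-faces of $\mathcal Q$ are isomorphic to one regular $k$-polytope $\mathcal K$, then $\mathcal R$ can be chosen such that, in addition, all its $k$-faces are isomorphic to $\mathcal K$. -/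

import Mathlib

universe u v

/-! ### String groups generated by involutions and string C-groups -/

/-- `G` together with the ordered family `g₀, …, gₙ₋₁` is a string group generated by involutions
(sggi) of rank `n`: the `gᵢ` are involutions (elements of order exactly two), they generate `G`,
and `(gⱼ gₖ)² = 1` whenever `|j - k| > 1`. Coincidences among the `gᵢ` are allowed. -/
structure IsSggi {G : Type u} [Group G] {n : ℕ} (g : Fin n → G) : Prop where
  closure_eq_top : Subgroup.closure (Set.range g) = ⊤
  orderOf_eq_two : ∀ i, orderOf (g i) = 2
  mul_sq_eq_one : ∀ j k : Fin n, (j : ℕ) + 1 < k → (g j * g k) ^ 2 = 1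

/-- An sggi is a string C-group if it satisfies the intersection condition
`⟨gₖ : k ∈ I⟩ ∩ ⟨gₖ : k ∈ J⟩ = ⟨gₖ : k ∈ I ∩ J⟩` for all sets `I`, `J` of indices. -/
structure IsStringCGroup {G : Type u} [Group G] {n : ℕ} (g : Fin n → G) : Prop
    extends IsSggi g where
  inter_eq : ∀ I J : Set (Fin n),
    Subgroup.closure (g '' I) ⊓ Subgroup.closure (g '' J) = Subgroup.closure (g '' (I ∩ J))

/-- The group `H` with generators `hᵢ` covers the group `G` with generators `gᵢ`: there is an
epimorphism from `H` onto `G` that maps the specified generators to the specified generators,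
in order. -/
def SggiCovers {H : Type u} [Group H] {G : Type v} [Group G] {n : ℕ}
    (h : Fin n → H) (g : Fin n → G) : Prop :=
  ∃ φ : H →* G, Function.Surjective φ ∧ ∀ i, φ (h i) = g i

/-! ### Flags and adjacency

A flag is a maximal chain, which is Mathlib's `Flag`. -/

/-- With respect to a rank function `r`, two flags are `j`-adjacent if they are different, but
contain the same elements of each rank other than `j`. -/
def FlagAdjAt {α : Type u} [PartialOrder α] (r : α → ℤ) (j : ℤ) (Φ Ψ : Flag α) : Prop :=
  Φ ≠ Ψ ∧ ∀ a : α, r a ≠ j → (a ∈ Φ ↔ a ∈ Ψ)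

/-- The flag graph: two flags are joined if they differ in just the element of one rank. -/
def flagGraph {α : Type u} [PartialOrder α] (r : α → ℤ) : SimpleGraph (Flag α) where
  Adj Φ Ψ := ∃ j, FlagAdjAt r j Φ Ψ
  symm := ⟨fun _ _ ⟨j, hne, h⟩ => ⟨j, hne.symm, fun a ha => (h a ha).symm⟩⟩
  loopless := ⟨fun _ ⟨_, hne, _⟩ => hne rfl⟩

/-! ### Abstract polytopes -/

/-- An abstract polytope of rank `n` (an abstract `n`-polytope). The rank `n` is an integer; the
axioms force `n ≥ -1`, and the polytope of rank `-1` has just one face. -/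
structure AbstractPolytope (n : ℤ) where
  /-- The faces. -/
  Face : Type u
  /-- Incidence is given by a partial order. -/
  [partialOrder : PartialOrder Face]
  /-- There are a least face `⊥` and a greatest face `⊤`. -/
  [boundedOrder : BoundedOrder Face]
  /-- The rank function. -/
  rank : Face → ℤ
  rank_strictMono : StrictMono rank
  /-- The rank goes up in steps of one, so that each flag has a face of each rank
  `-1, 0, …, n`, and therefore contains `n + 2` faces. -/
  rank_covBy : ∀ F G : Face, F ⋖ G → rank G = rank F + 1
  rank_bot : rank ⊥ = -1
  rank_top : rank ⊤ = n
  /-- If `F < G` have ranks `j - 1` and `j + 1`, then exactly two faces lie strictly between. -/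
  diamond : ∀ F G : Face, F < G → rank G = rank F + 2 → (Set.Ioo F G).ncard = 2
  /-- Strong flag-connectedness: each section `G / F = {H | F ≤ H ≤ G}` has a connected
  flag graph. -/
  strongly_flag_connected : ∀ F G : Face, F ≤ G →
    (flagGraph (fun H : Set.Icc F G => rank H)).Connected

attribute [instance] AbstractPolytope.partialOrder AbstractPolytope.boundedOrder

namespace AbstractPolytope

/-- A polytope is regular if its automorphism group is transitive on its flags. -/
def IsRegular {n : ℤ} (P : AbstractPolytope.{u} n) : Prop :=
  ∀ Φ Ψ : Flag P.Face, ∃ γ : P.Face ≃o P.Face, Flag.map γ Φ = Ψ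

/-- A covering `η : R → P` of `n`-polytopes: a rank and adjacency preserving homomorphism. -/
structure IsCovering {n : ℤ} (R : AbstractPolytope.{u} n) (P : AbstractPolytope.{v} n)
    (η : R.Face → P.Face) : Prop where
  monotone : Monotone η
  rank_eq : ∀ F, P.rank (η F) = R.rank F
  /-- The images of two `j`-adjacent flags are again two `j`-adjacent flags. -/
  adjacent : ∀ (j : ℤ) (Φ Ψ : Flag R.Face), FlagAdjAt R.rank j Φ Ψ →
    ∃ Φ' Ψ' : Flag P.Face, (Φ' : Set P.Face) = η '' Φ ∧ (Ψ' : Set P.Face) = η '' Ψ ∧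
      FlagAdjAt P.rank j Φ' Ψ'

/-- `R` covers `P` if there is a covering `R → P`. -/
def Covers {n : ℤ} (R : AbstractPolytope.{u} n) (P : AbstractPolytope.{v} n) : Prop :=
  ∃ η : R.Face → P.Face, IsCovering R P η

/-- All `k`-faces `F` of `P`, regarded as the sections `F / ⊥`, are isomorphic to `K`. -/
def AllFacesIso {n : ℤ} (P : AbstractPolytope.{u} n) (k : ℤ) (K : AbstractPolytope.{v} k) : Prop :=
  ∀ F : P.Face, P.rank F = k → Nonempty (Set.Icc ⊥ F ≃o K.Face)

end AbstractPolytope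

/-! For (a), let `g` generate `P`. In the power `P^(n+1)`, replace `gᵢ` by the tuple whose
coordinate `m` is `gᵢ` if `i < m` and `1` otherwise. These tuples still satisfy the string
relations, and the last coordinate recovers `g`. Copying coordinate `m` into all later coordinates
is an endomorphism that fixes the tuples of index less than `m` and kills the others. Hence an
element of the span of an index set `J` that also lies in the span of the first `m` tuples is a word
in those of index in `J` below `m` (`closure_truncations_inf_le`). By induction on `m`, this special
case gives the full intersection condition (`interCondBelow_succ`).

For (b), the adjacency involutions on the flags of `Q` generate the connection group, a finite sggi.
A string C-group `Γ` covering it has a regular coset polytope: its `j`-faces are the left cosets of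
`⟨γᵢ : i ≠ j⟩`, incident when they meet, and left multiplication is transitive on flags. Letting
elements of `Γ` move a base flag of `Q` sends flags to flags. A generator other than `γⱼ` does not
change the `j`-face, so this descends to a covering of faces.

For prescribed `k`-faces, truncate at ranks from `k` on only, so that the first `k` generators
become constant tuples and span an isomorphic copy of the original group. The induction then needs
the intersection condition for these `k` generators of the connection group. If all `k`-faces are
isomorphic to one regular polytope, they span a group acting freely on flags (`eq_one_of_apply_eq`):
an isomorphism matching the faces of two flags up to rank `k` commutes with adjacencies below `k`.
Freeness and strong flag-connectedness give the condition (`interCondBelow_swapPerm`). Freeness and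
injectivity of the cover on this span make the covering an isomorphism on `k`-faces
(`nonempty_section_orderIso`). -/

/-! ### The intersection condition on initial segments -/

theorem Subgroup.exists_mul_of_mem_closure_union {G : Type*} [Group G] {s t : Set G}
    (h : ∀ a ∈ s, ∀ b ∈ t, Commute a b) {x : G} (hx : x ∈ Subgroup.closure (s ∪ t)) :
    ∃ a ∈ Subgroup.closure s, ∃ b ∈ Subgroup.closure t, x = a * b := by
  have hst : ∀ a ∈ Subgroup.closure s, ∀ b ∈ Subgroup.closure t, a * b = b * a := by
    have h1 : Subgroup.closure s ≤ Subgroup.centralizer (Subgroup.closure t : Set G) := by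
      rw [Subgroup.closure_le, Subgroup.centralizer_closure]
      intro a ha b hb
      exact (h a ha b hb).symm.eq
    intro a ha b hb
    exact ((Subgroup.mem_centralizer_iff.1 (h1 ha)) b hb).symm
  induction hx using Subgroup.closure_induction with
  | mem x hx =>
    rcases hx with hx | hx
    · exact ⟨x, Subgroup.subset_closure hx, 1, one_mem _, (mul_one x).symm⟩
    · exact ⟨1, one_mem _, x, Subgroup.subset_closure hx, (one_mul x).symm⟩
  | one => exact ⟨1, one_mem _, 1, one_mem _, (mul_one 1).symm⟩
  | mul x y _ _ hx hy =>
    obtain ⟨a, ha, b, hb, rfl⟩ := hx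
    obtain ⟨c, hc, d, hd, rfl⟩ := hy
    refine ⟨a * c, mul_mem ha hc, b * d, mul_mem hb hd, ?_⟩
    rw [mul_assoc, ← mul_assoc b, ← hst c hc b hb]
    simp only [mul_assoc]
  | inv x _ hx =>
    obtain ⟨a, ha, b, hb, rfl⟩ := hx
    exact ⟨a⁻¹, inv_mem ha, b⁻¹, inv_mem hb, by
      rw [mul_inv_rev, hst _ (inv_mem ha) _ (inv_mem hb)]⟩

/-- The intersection condition for the generators with indices less than `m`. -/
def InterCondBelow {G : Type*} [Group G] {n : ℕ} (g : Fin n → G) (m : ℕ) : Prop :=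
  ∀ I J : Set (Fin n), (∀ i ∈ I, (i : ℕ) < m) → (∀ i ∈ J, (i : ℕ) < m) →
    Subgroup.closure (g '' I) ⊓ Subgroup.closure (g '' J) ≤ Subgroup.closure (g '' (I ∩ J))

section InterCond

variable {G : Type*} [Group G] {n : ℕ} {g : Fin n → G}

theorem closure_image_mono {I J : Set (Fin n)} (h : I ⊆ J) :
    Subgroup.closure (g '' I) ≤ Subgroup.closure (g '' J) :=
  Subgroup.closure_mono (Set.image_mono h)

theorem exists_mul_of_lt_pred {I : Set (Fin n)} {a : ℕ}
    (hcomm : ∀ i j : Fin n, (i : ℕ) + 1 < j → Commute (g i) (g j))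
    (ha : ∀ i ∈ I, (i : ℕ) + 1 ≠ a) {x : G} (hx : x ∈ Subgroup.closure (g '' I)) :
    ∃ h ∈ Subgroup.closure (g '' {i | i ∈ I ∧ (i : ℕ) < a}),
      ∃ y ∈ Subgroup.closure (g '' {i | i ∈ I ∧ a ≤ (i : ℕ)}), x = h * y := by
  refine Subgroup.exists_mul_of_mem_closure_union ?_ ?_
  · rintro _ ⟨i, ⟨hi, hia⟩, rfl⟩ _ ⟨j, ⟨hj, hja⟩, rfl⟩
    have := ha i hi
    exact hcomm i j (by omega)
  · rw [← Set.image_union]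
    refine closure_image_mono ?_ hx
    intro i hi
    rcases lt_or_ge (i : ℕ) a with h | h
    · exact Or.inl ⟨hi, h⟩
    · exact Or.inr ⟨hi, h⟩

/-- Take the longest run `[a, m]` inside `I`. The gap at `a - 1` is what `exists_mul_of_lt_pred`
needs: generators on its two sides commute. -/
theorem exists_terminal_interval {I : Set (Fin n)} {m : ℕ} (hm : ∀ i : Fin n, (i : ℕ) = m → i ∈ I) :
    ∃ a ≤ m, (∀ i : Fin n, a ≤ (i : ℕ) → (i : ℕ) ≤ m → i ∈ I) ∧ ∀ i ∈ I, (i : ℕ) + 1 ≠ a := by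
  classical
  have hex : ∃ a, a ≤ m ∧ ∀ i : Fin n, a ≤ (i : ℕ) → (i : ℕ) ≤ m → i ∈ I :=
    ⟨m, le_rfl, fun i h1 h2 => hm i (le_antisymm h2 h1)⟩
  refine ⟨Nat.find hex, (Nat.find_spec hex).1, (Nat.find_spec hex).2, ?_⟩
  intro i hi hia
  have hlt : (i : ℕ) < Nat.find hex := by omega
  refine Nat.find_min hex hlt ⟨by have := (Nat.find_spec hex).1; omega, fun j hj hjm => ?_⟩
  rcases hj.eq_or_lt with h | h
  · rwa [← Fin.ext h]
  · exact (Nat.find_spec hex).2 j (by omega) hjm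

/-- If one of `I`, `J` misses `m`, then `h2` removes `m` from the other. Otherwise split a common
element at the terminal runs `[a, m]` of `I` and `[b, m]` of `J`, with `a ≤ b` by symmetry, and
compare the two factorizations. -/
theorem interCondBelow_succ {m : ℕ}
    (hcomm : ∀ i j : Fin n, (i : ℕ) + 1 < j → Commute (g i) (g j))
    (h1 : InterCondBelow g m)
    (h2 : ∀ J : Set (Fin n), Subgroup.closure (g '' {i | (i : ℕ) < m}) ⊓ Subgroup.closure (g '' J) ≤
      Subgroup.closure (g '' {i | i ∈ J ∧ (i : ℕ) < m})) :
    InterCondBelow g (m + 1) := by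
  have key : ∀ (I J : Set (Fin n)) (a b : ℕ), (∀ i ∈ I, (i : ℕ) < m + 1) →
      (∀ i ∈ J, (i : ℕ) < m + 1) → a ≤ b → b ≤ m →
      (∀ i : Fin n, a ≤ (i : ℕ) → (i : ℕ) ≤ m → i ∈ I) → (∀ i ∈ I, (i : ℕ) + 1 ≠ a) →
      (∀ i : Fin n, b ≤ (i : ℕ) → (i : ℕ) ≤ m → i ∈ J) → (∀ i ∈ J, (i : ℕ) + 1 ≠ b) →
      Subgroup.closure (g '' I) ⊓ Subgroup.closure (g '' J) ≤
        Subgroup.closure (g '' (I ∩ J)) := by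
    intro I J a b hI hJ hab hbm haI ha hbJ hb x hx
    obtain ⟨h, hh, y, hy, rfl⟩ := exists_mul_of_lt_pred hcomm ha hx.1
    obtain ⟨h', hh', y', hy', hxy⟩ := exists_mul_of_lt_pred hcomm hb hx.2
    -- The left side avoids `m` and the right side lies in the span of `[a, m]`, so `h2` puts this
    -- element in the span of `[a, m)`. Thus `h'` lies in the span of `I` below `m`, and `h1`
    -- applies to it.
    have hz : h⁻¹ * h' = y * y'⁻¹ := by
      rw [inv_mul_eq_iff_eq_mul, ← mul_assoc, hxy, mul_inv_cancel_right]
    have hz1 : h⁻¹ * h' ∈ Subgroup.closure (g '' {i | (i : ℕ) < m}) := by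
      refine mul_mem (inv_mem (closure_image_mono ?_ hh)) (closure_image_mono ?_ hh')
      · rintro i ⟨-, hi⟩
        exact hi.trans_le (hab.trans hbm)
      · rintro i ⟨-, hi⟩
        exact hi.trans_le hbm
    have hz2 : h⁻¹ * h' ∈ Subgroup.closure (g '' {i | i ∈ I ∧ a ≤ (i : ℕ)}) := by
      rw [hz]
      refine mul_mem hy (inv_mem (closure_image_mono ?_ hy'))
      rintro i ⟨hi, hbi⟩
      exact ⟨haI i (hab.trans hbi) (Nat.lt_succ_iff.1 (hJ i hi)), hab.trans hbi⟩
    have hz3 := h2 _ ⟨hz1, hz2⟩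
    have hh1 : h' ∈ Subgroup.closure (g '' {i | i ∈ I ∧ (i : ℕ) < m}) := by
      rw [← mul_inv_cancel_left h h']
      refine mul_mem (closure_image_mono ?_ hh) (closure_image_mono ?_ hz3)
      · rintro i ⟨hi, hia⟩
        exact ⟨hi, hia.trans_le (hab.trans hbm)⟩
      · rintro i ⟨⟨hi, -⟩, him⟩
        exact ⟨hi, him⟩
    have hh2 := h1 _ _ (fun i hi => hi.2) (fun i hi => hi.2.trans_le hbm) ⟨hh1, hh'⟩
    rw [hxy]
    refine mul_mem (closure_image_mono ?_ hh2) (closure_image_mono ?_ hy')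
    · rintro i ⟨hi, hi'⟩
      exact ⟨hi.1, hi'.1⟩
    · rintro i ⟨hi, hbi⟩
      exact ⟨haI i (hab.trans hbi) (Nat.lt_succ_iff.1 (hJ i hi)), hi⟩
  have key2 : ∀ (I J : Set (Fin n)), (∀ i ∈ I, (i : ℕ) < m) → (∀ i ∈ J, (i : ℕ) < m + 1) →
      Subgroup.closure (g '' I) ⊓ Subgroup.closure (g '' J) ≤
        Subgroup.closure (g '' (I ∩ J)) := by
    intro I J hI hJ x hx
    have hx' := h2 J ⟨closure_image_mono (fun i hi => hI i hi) hx.1, hx.2⟩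
    refine closure_image_mono ?_ (h1 _ _ hI (fun i hi => hi.2) ⟨hx.1, hx'⟩)
    rintro i ⟨hi, hi'⟩
    exact ⟨hi, hi'.1⟩
  intro I J hI hJ
  by_cases hmI : ∀ i : Fin n, (i : ℕ) = m → i ∈ I
  · by_cases hmJ : ∀ i : Fin n, (i : ℕ) = m → i ∈ J
    · obtain ⟨a, ham, haI, ha⟩ := exists_terminal_interval hmI
      obtain ⟨b, hbm, hbJ, hb⟩ := exists_terminal_interval hmJ
      rcases le_total a b with hab | hab
      · exact key I J a b hI hJ hab hbm haI ha hbJ hb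
      · rw [inf_comm, Set.inter_comm]
        exact key J I b a hJ hI hab ham hbJ hb haI ha
    · push Not at hmJ
      obtain ⟨j, hj, hjJ⟩ := hmJ
      rw [inf_comm, Set.inter_comm]
      refine key2 J I (fun i hi => ?_) hI
      have : i ≠ j := fun h => hjJ (h ▸ hi)
      have := hJ i hi
      have : (i : ℕ) ≠ j := fun h => ‹i ≠ j› (Fin.ext h)
      omega
  · push Not at hmI
    obtain ⟨j, hj, hjI⟩ := hmI
    refine key2 I J (fun i hi => ?_) hJ
    have : i ≠ j := fun h => hjI (h ▸ hi)
    have := hI i hi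
    have : (i : ℕ) ≠ j := fun h => ‹i ≠ j› (Fin.ext h)
    omega

/-! ### Truncated generators in a power of the group -/

/-- The generators `gᵢ`, truncated at all ranks from `k` to `n`. -/
def truncations (g : Fin n → G) (k : ℕ) (i : Fin n) : Fin (n + 1) → G :=
  fun m => if (i : ℕ) < max k m then g i else 1

theorem closure_truncations_inf_le {k m : ℕ} (hkm : k ≤ m) (hmn : m ≤ n) (J : Set (Fin n)) :
    Subgroup.closure (truncations g k '' {i | (i : ℕ) < m}) ⊓
        Subgroup.closure (truncations g k '' J) ≤
      Subgroup.closure (truncations g k '' {i | i ∈ J ∧ (i : ℕ) < m}) := by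
  -- Coordinates beyond `m` are overwritten by coordinate `m`. This fixes the generators of index
  -- less than `m` and, since `k ≤ m`, kills the rest.
  let π : (Fin (n + 1) → G) →* (Fin (n + 1) → G) :=
    { toFun := fun f l => f (min l ⟨m, Nat.lt_succ_of_le hmn⟩)
      map_one' := rfl
      map_mul' := fun _ _ => rfl }
  have hmin : ∀ l : Fin (n + 1), ((min l ⟨m, Nat.lt_succ_of_le hmn⟩ : Fin (n + 1)) : ℕ) =
      min (l : ℕ) m := fun l => by
    rcases le_total l ⟨m, Nat.lt_succ_of_le hmn⟩ with h | h
    · rw [min_eq_left h, min_eq_left (Fin.le_def.1 h)]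
    · rw [min_eq_right h, min_eq_right (Fin.le_def.1 h)]
  have h1 : ∀ i : Fin n, (i : ℕ) < m → π (truncations g k i) = truncations g k i := by
    intro i hi
    funext l
    change truncations g k i (min l _) = _
    simp only [truncations, hmin]
    congr 1
    simp only [lt_sup_iff, lt_inf_iff, eq_iff_iff]
    tauto
  have h2 : ∀ i : Fin n, ¬ (i : ℕ) < m → π (truncations g k i) = 1 := by
    intro i hi
    funext l
    change truncations g k i (min l _) = _
    simp only [truncations, hmin]
    rw [if_neg]
    · rfl
    · simp only [lt_sup_iff, lt_inf_iff]
      omega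
  rintro x ⟨hx1, hx2⟩
  have hfix : Set.EqOn π (MonoidHom.id _)
      (Subgroup.closure (truncations g k '' {i | (i : ℕ) < m}) : Set (Fin (n + 1) → G)) := by
    apply MonoidHom.eqOn_closure
    rintro _ ⟨i, hi, rfl⟩
    exact h1 i hi
  rw [← show π x = x from hfix hx1]
  have : Subgroup.closure (truncations g k '' J) ≤
      (Subgroup.closure (truncations g k '' {i | i ∈ J ∧ (i : ℕ) < m})).comap π := by
    rw [Subgroup.closure_le]
    rintro _ ⟨i, hi, rfl⟩
    change π _ ∈ Subgroup.closure _
    by_cases him : (i : ℕ) < m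
    · rw [h1 i him]
      exact Subgroup.subset_closure ⟨i, ⟨hi, him⟩, rfl⟩
    · rw [h2 i him]
      exact one_mem _
  exact this hx2

theorem truncations_last {k : ℕ} (i : Fin n) : truncations g k i (Fin.last n) = g i := by
  simp [truncations]

/-- The first `k` generators are never truncated, so their span is diagonal and the last coordinate
is injective on it. -/
theorem eq_of_mem_closure_truncations {k : ℕ} {x : Fin (n + 1) → G}
    (hx : x ∈ Subgroup.closure (truncations g k '' {i | (i : ℕ) < k})) (m : Fin (n + 1)) :
    x m = x (Fin.last n) := by
  have : Set.EqOn (Pi.evalMonoidHom (fun _ : Fin (n + 1) => G) m)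
      (Pi.evalMonoidHom (fun _ : Fin (n + 1) => G) (Fin.last n))
      (Subgroup.closure (truncations g k '' {i | (i : ℕ) < k}) : Set (Fin (n + 1) → G)) := by
    apply MonoidHom.eqOn_closure
    rintro _ ⟨i, hi, rfl⟩
    have hi' : (i : ℕ) < k := hi
    simp [truncations, hi']
  exact this hx

theorem interCondBelow_truncations {k : ℕ} (hk : k ≤ n)
    (hcomm : ∀ i j : Fin n, (i : ℕ) + 1 < j → Commute (g i) (g j))
    (h : InterCondBelow g k) : InterCondBelow (truncations g k) n := by
  have hcomm' : ∀ i j : Fin n, (i : ℕ) + 1 < j →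
      Commute (truncations g k i) (truncations g k j) := by
    intro i j hij
    funext m
    simp only [truncations, Pi.mul_apply]
    have := (hcomm i j hij).eq
    split_ifs <;> simp [this]
  -- Project to the last coordinate, use the condition for `g`, and lift back along the diagonal.
  have hbase : InterCondBelow (truncations g k) k := by
    intro I J hI hJ x hx
    have hmap : ∀ I : Set (Fin n),
        (Subgroup.closure (truncations g k '' I)).map
          (Pi.evalMonoidHom (fun _ : Fin (n + 1) => G) (Fin.last n)) =
            Subgroup.closure (g '' I) := by
      intro I
      rw [MonoidHom.map_closure, Set.image_image]
      simp only [Pi.evalMonoidHom_apply, truncations_last]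
    have hx' := h I J hI hJ
      ⟨hmap I ▸ Subgroup.mem_map_of_mem _ hx.1, hmap J ▸ Subgroup.mem_map_of_mem _ hx.2⟩
    rw [← hmap, Subgroup.mem_map] at hx'
    obtain ⟨y, hy, hyx⟩ := hx'
    have : y = x := by
      funext m
      rw [eq_of_mem_closure_truncations (closure_image_mono (fun i hi => hI i hi.1) hy) m,
        eq_of_mem_closure_truncations (closure_image_mono (fun i hi => hI i hi) hx.1) m]
      exact hyx
    exact this ▸ hy
  have : ∀ m, k ≤ m → m ≤ n → InterCondBelow (truncations g k) m := by
    intro m hkm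
    induction m, hkm using Nat.le_induction with
    | base => exact fun _ => hbase
    | succ m hkm ih =>
      intro hmn
      exact interCondBelow_succ hcomm' (ih (by omega))
        (closure_truncations_inf_le hkm (by omega))
  exact this n hk le_rfl

end InterCond

/-- A finite string group of involutions whose first `k` generators satisfy the intersection
condition is covered by a finite string C-group, injectively on the span of these generators. -/
theorem exists_isStringCGroup_hom {P : Type u} [Group P] [Finite P] {n : ℕ} (g : Fin n → P)
    (h2 : ∀ i, orderOf (g i) = 2) (hs : ∀ j k : Fin n, (j : ℕ) + 1 < k → (g j * g k) ^ 2 = 1)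
    (k : ℕ) (hk : k ≤ n) (h : InterCondBelow g k) :
    ∃ (Γ : Type u) (_ : Group Γ) (_ : Finite Γ) (γ : Fin n → Γ) (φ : Γ →* P),
      IsStringCGroup γ ∧ (∀ i, φ (γ i) = g i) ∧
        ∀ x ∈ Subgroup.closure (γ '' {i | (i : ℕ) < k}), φ x = 1 → x = 1 := by
  have hsq : ∀ i, g i * g i = 1 := fun i => by rw [← pow_two, ← h2 i, pow_orderOf_eq_one]
  have hcomm : ∀ i j : Fin n, (i : ℕ) + 1 < j → Commute (g i) (g j) := by
    intro i j hij
    have h3 := hs i j hij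
    have hi : (g i)⁻¹ = g i := inv_eq_of_mul_eq_one_left (hsq i)
    have hj : (g j)⁻¹ = g j := inv_eq_of_mul_eq_one_left (hsq j)
    rw [pow_two] at h3
    have := eq_inv_of_mul_eq_one_left h3
    rwa [mul_inv_rev, hi, hj] at this
  set S : Subgroup (Fin (n + 1) → P) := Subgroup.closure (Set.range (truncations g k)) with hS
  have hmem : ∀ i, truncations g k i ∈ S := fun i => Subgroup.subset_closure ⟨i, rfl⟩
  let γ : Fin n → S := fun i => ⟨truncations g k i, hmem i⟩
  -- Spans inside `S` are compared through their images in the full power.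
  have hmap : ∀ I : Set (Fin n), (Subgroup.closure (γ '' I)).map S.subtype =
      Subgroup.closure (truncations g k '' I) := by
    intro I
    rw [MonoidHom.map_closure, Set.image_image]
    rfl
  have hinj := Subgroup.map_injective S.subtype_injective
  refine ⟨S, inferInstance, inferInstance, γ,
    (Pi.evalMonoidHom (fun _ : Fin (n + 1) => P) (Fin.last n)).comp S.subtype, ?_,
    fun i => truncations_last i, ?_⟩
  · refine ⟨⟨?_, ?_, ?_⟩, ?_⟩
    · apply hinj
      rw [← Set.image_univ, hmap, Set.image_univ, ← hS, ← MonoidHom.range_eq_map,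
        Subgroup.range_subtype]
    · intro i
      refine orderOf_eq_prime ?_ ?_
      · apply Subtype.ext
        funext m
        change (truncations g k i ^ 2) m = 1
        rw [Pi.pow_apply, truncations]
        split_ifs
        · rw [pow_two, hsq]
        · exact one_pow 2
      · intro hi
        have := congrFun (congrArg Subtype.val hi) (Fin.last n)
        rw [show ((γ i : Fin (n + 1) → P)) (Fin.last n) = g i from truncations_last i] at this
        have h4 := h2 i
        rw [this] at h4
        simp at h4
    · intro i j hij
      apply Subtype.ext
      funext m
      change ((truncations g k i * truncations g k j) ^ 2) m = 1
      rw [Pi.pow_apply, Pi.mul_apply]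
      simp only [truncations]
      have hi := hsq i
      have hj := hsq j
      have := hs i j hij
      rw [← pow_two] at hi hj
      split_ifs <;> simp [this, hi, hj]
    · intro I J
      apply hinj
      rw [Subgroup.map_inf _ _ _ S.subtype_injective, hmap, hmap, hmap]
      refine le_antisymm (interCondBelow_truncations hk hcomm h I J
        (fun i _ => i.2) (fun i _ => i.2)) (le_inf ?_ ?_)
      · exact closure_image_mono Set.inter_subset_left
      · exact closure_image_mono Set.inter_subset_right
  · intro x hx hx1
    have hx' : (x : Fin (n + 1) → P) ∈
        Subgroup.closure (truncations g k '' {i | (i : ℕ) < k}) := by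
      rw [← hmap]
      exact Subgroup.mem_map_of_mem S.subtype hx
    apply Subtype.ext
    funext m
    rw [eq_of_mem_closure_truncations hx' m]
    exact hx1

/-! ### The coset polytope of a string C-group -/

section CosetPolytope

variable {Γ : Type u} [Group Γ] {N : ℕ} {γ : Fin N → Γ}

/-- The subgroup generated by all `γᵢ` with `i ≠ j`. -/
def faceStabilizer (γ : Fin N → Γ) (j : ℤ) : Subgroup Γ :=
  Subgroup.closure (γ '' {i | (i : ℤ) ≠ j})

theorem closure_image_le_faceStabilizer {I : Set (Fin N)} {j : ℤ} (h : ∀ i ∈ I, (i : ℤ) ≠ j) :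
    Subgroup.closure (γ '' I) ≤ faceStabilizer γ j :=
  closure_image_mono h

namespace IsSggi

theorem mul_self (hγ : IsSggi γ) (i : Fin N) : γ i * γ i = 1 := by
  rw [← pow_two, ← hγ.orderOf_eq_two i, pow_orderOf_eq_one]

theorem ne_one (hγ : IsSggi γ) (i : Fin N) : γ i ≠ 1 := by
  intro h
  have := hγ.orderOf_eq_two i
  rw [h] at this
  simp at this

theorem commute_of_lt (hγ : IsSggi γ) {i j : Fin N} (hij : (i : ℕ) + 1 < j) :
    Commute (γ i) (γ j) := by
  have h3 := hγ.mul_sq_eq_one i j hij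
  have hi : (γ i)⁻¹ = γ i := inv_eq_of_mul_eq_one_left (hγ.mul_self i)
  have hj : (γ j)⁻¹ = γ j := inv_eq_of_mul_eq_one_left (hγ.mul_self j)
  rw [pow_two] at h3
  have := eq_inv_of_mul_eq_one_left h3
  rwa [mul_inv_rev, hi, hj] at this

theorem exists_lower_mul_upper (hγ : IsSggi γ) {j : ℤ} {w : Γ} (hw : w ∈ faceStabilizer γ j) :
    ∃ a ∈ Subgroup.closure (γ '' {i | (i : ℤ) < j}),
      ∃ b ∈ Subgroup.closure (γ '' {i | j < (i : ℤ)}), w = a * b := by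
  refine Subgroup.exists_mul_of_mem_closure_union ?_ ?_
  · rintro _ ⟨i, hi, rfl⟩ _ ⟨l, hl, rfl⟩
    simp only [Set.mem_ofPred_eq] at hi hl
    exact hγ.commute_of_lt (by omega)
  · rw [← Set.image_union]
    refine closure_image_mono ?_ hw
    intro i hi
    exact lt_or_gt_of_ne (show (i : ℤ) ≠ j from hi)

theorem exists_upper_mul_lower (hγ : IsSggi γ) {j : ℤ} {w : Γ} (hw : w ∈ faceStabilizer γ j) :
    ∃ b ∈ Subgroup.closure (γ '' {i | j < (i : ℤ)}),
      ∃ a ∈ Subgroup.closure (γ '' {i | (i : ℤ) < j}), w = b * a := by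
  obtain ⟨a, ha, b, hb, h⟩ := hγ.exists_lower_mul_upper (inv_mem hw)
  exact ⟨b⁻¹, inv_mem hb, a⁻¹, inv_mem ha, by rw [← mul_inv_rev, ← h, inv_inv]⟩

/-- This serves the ranks `-1` and `N`, which have a single face each. -/
theorem faceStabilizer_eq_top (hγ : IsSggi γ) {j : ℤ} (hj : ∀ i : Fin N, (i : ℤ) ≠ j) :
    faceStabilizer γ j = ⊤ := by
  rw [faceStabilizer, ← hγ.closure_eq_top, ← Set.image_univ]
  congr 2
  ext i
  simp [hj i]

theorem mem_closure_singleton (hγ : IsSggi γ) {i : Fin N} {w : Γ}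
    (hw : w ∈ Subgroup.closure {γ i}) : w = 1 ∨ w = γ i := by
  induction hw using Subgroup.closure_induction with
  | mem x hx => exact Or.inr hx
  | one => exact Or.inl rfl
  | mul x y _ _ hx hy =>
    rcases hx with rfl | rfl <;> rcases hy with rfl | rfl <;> simp [hγ.mul_self]
  | inv x _ hx =>
    rcases hx with rfl | rfl
    · simp
    · exact Or.inr (inv_eq_of_mul_eq_one_left (hγ.mul_self i))

end IsSggi

theorem IsStringCGroup.mem_closure_compl (hγ : IsStringCGroup γ) {w : Γ} (T : Finset (Fin N))
    (hw : ∀ i ∈ T, w ∈ faceStabilizer γ i) : w ∈ Subgroup.closure (γ '' {i | i ∉ T}) := by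
  classical
  induction T using Finset.induction_on with
  | empty => simp [hγ.closure_eq_top]
  | insert i T _ ih =>
    have h1 := ih fun l hl => hw l (Finset.mem_insert_of_mem hl)
    have h2 := hw i (Finset.mem_insert_self i T)
    have h3 : w ∈ Subgroup.closure (γ '' ({l | l ∉ T} ∩ {l | (l : ℤ) ≠ (i : ℤ)})) := by
      rw [← hγ.inter_eq]
      exact ⟨h1, h2⟩
    refine closure_image_mono ?_ h3
    rintro l ⟨hl, hli⟩
    simp only [Set.mem_ofPred_eq, Finset.mem_insert, not_or]
    exact ⟨fun h => hli (by rw [h]), hl⟩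

theorem IsStringCGroup.mem_closure_of_forall_mem (hγ : IsStringCGroup γ) {w : Γ} (T : Set (Fin N))
    (hw : ∀ i ∉ T, w ∈ faceStabilizer γ i) : w ∈ Subgroup.closure (γ '' T) := by
  classical
  refine closure_image_mono ?_ (hγ.mem_closure_compl {i | i ∉ T}.toFinset (fun i hi => hw i ?_))
  · intro i hi
    simpa using hi
  · simpa using hi

/-- The faces of the coset polytope: the left cosets of the face stabilizers, with their ranks. -/
@[ext]
structure CosetFace (hγ : IsStringCGroup γ) where
  rank : ℤ
  carrier : Set Γ
  neg_one_le_rank : -1 ≤ rank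
  rank_le : rank ≤ N
  exists_rep : ∃ x, carrier = {y | x⁻¹ * y ∈ faceStabilizer γ rank}

namespace CosetFace

variable {hγ : IsStringCGroup γ}

theorem nonempty (F : CosetFace hγ) : F.carrier.Nonempty := by
  obtain ⟨x, hx⟩ := F.exists_rep
  exact ⟨x, by rw [hx]; simp [one_mem]⟩

theorem mem_iff {F : CosetFace hγ} {x y : Γ} (hx : x ∈ F.carrier) :
    y ∈ F.carrier ↔ x⁻¹ * y ∈ faceStabilizer γ F.rank := by
  obtain ⟨z, hz⟩ := F.exists_rep
  rw [hz] at hx ⊢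
  have hx' : z⁻¹ * x ∈ faceStabilizer γ F.rank := hx
  change z⁻¹ * y ∈ faceStabilizer γ F.rank ↔ x⁻¹ * y ∈ faceStabilizer γ F.rank
  rw [← Subgroup.mul_mem_cancel_left (y := x⁻¹ * y) _ hx', mul_assoc, mul_inv_cancel_left]

theorem mul_mem {F : CosetFace hγ} {x w : Γ} (hx : x ∈ F.carrier)
    (hw : w ∈ faceStabilizer γ F.rank) : x * w ∈ F.carrier := by
  rw [mem_iff hx, inv_mul_cancel_left]
  exact hw

theorem eq_of_mem {F G : CosetFace hγ} {x : Γ} (h : F.rank = G.rank) (hF : x ∈ F.carrier)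
    (hG : x ∈ G.carrier) : F = G := by
  ext y
  · exact h
  · rw [mem_iff hF, mem_iff hG, h]

/-- The face of rank `j` that contains `x`. -/
def mk' (hγ : IsStringCGroup γ) (x : Γ) (j : ℤ) (h1 : -1 ≤ j) (h2 : j ≤ N) : CosetFace hγ :=
  ⟨j, {y | x⁻¹ * y ∈ faceStabilizer γ j}, h1, h2, x, rfl⟩

theorem mem_mk' {x : Γ} {j : ℤ} {h1 : -1 ≤ j} {h2 : j ≤ N} : x ∈ (mk' hγ x j h1 h2).carrier := by
  change x⁻¹ * x ∈ faceStabilizer γ j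
  rw [inv_mul_cancel]
  exact one_mem _

/-- Ranks are compared separately because carriers do not determine them: the least and the greatest
face both have carrier `Γ`. -/
instance : LE (CosetFace hγ) where
  le F G := F.rank ≤ G.rank ∧ (F.carrier ∩ G.carrier).Nonempty

theorem le_of_mem {F G : CosetFace hγ} {x : Γ} (h : F.rank ≤ G.rank) (hF : x ∈ F.carrier)
    (hG : x ∈ G.carrier) : F ≤ G := ⟨h, x, hF, hG⟩

/-- Factor an element of the stabilizer of `F` into commuting upper and lower parts; the lower part
also stabilizes `G` and can be dropped. The remaining correction `b` preserves every face through
`x` of rank at most that of `F`. -/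
theorem exists_upper_mul_mem {F G : CosetFace hγ} (h : F ≤ G) {x : Γ} (hx : x ∈ F.carrier) :
    ∃ b ∈ Subgroup.closure (γ '' {i | F.rank < (i : ℤ)}), x * b ∈ G.carrier := by
  obtain ⟨hr, y, hyF, hyG⟩ := h
  obtain ⟨b, hb, a, ha, hab⟩ := hγ.exists_upper_mul_lower ((mem_iff hx).1 hyF)
  refine ⟨b, hb, ?_⟩
  have : x * b = y * a⁻¹ := by
    rw [eq_mul_inv_iff_mul_eq, mul_assoc, ← hab, mul_inv_cancel_left]
  rw [this]
  refine mul_mem hyG (inv_mem (closure_image_le_faceStabilizer ?_ ha))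
  intro i hi
  simp only [Set.mem_ofPred_eq] at hi
  omega

theorem exists_lower_mul_mem {F G : CosetFace hγ} (h : F ≤ G) {x : Γ} (hx : x ∈ G.carrier) :
    ∃ a ∈ Subgroup.closure (γ '' {i | (i : ℤ) < G.rank}), x * a ∈ F.carrier := by
  obtain ⟨hr, y, hyF, hyG⟩ := h
  obtain ⟨a, ha, b, hb, hab⟩ := hγ.exists_lower_mul_upper ((mem_iff hx).1 hyG)
  refine ⟨a, ha, ?_⟩
  have : x * a = y * b⁻¹ := by
    rw [eq_mul_inv_iff_mul_eq, mul_assoc, ← hab, mul_inv_cancel_left]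
  rw [this]
  refine mul_mem hyF (inv_mem (closure_image_le_faceStabilizer ?_ hb))
  intro i hi
  simp only [Set.mem_ofPred_eq] at hi
  omega

theorem mul_upper_mem {F : CosetFace hγ} {j : ℤ} (hj : F.rank ≤ j) {x b : Γ} (hx : x ∈ F.carrier)
    (hb : b ∈ Subgroup.closure (γ '' {i | j < (i : ℤ)})) : x * b ∈ F.carrier := by
  refine mul_mem hx (closure_image_le_faceStabilizer ?_ hb)
  intro i hi
  simp only [Set.mem_ofPred_eq] at hi
  omega

theorem mul_lower_mem {F : CosetFace hγ} {j : ℤ} (hj : j ≤ F.rank) {x b : Γ} (hx : x ∈ F.carrier)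
    (hb : b ∈ Subgroup.closure (γ '' {i | (i : ℤ) < j})) : x * b ∈ F.carrier := by
  refine mul_mem hx (closure_image_le_faceStabilizer ?_ hb)
  intro i hi
  simp only [Set.mem_ofPred_eq] at hi
  omega

instance : PartialOrder (CosetFace hγ) where
  le_refl F := ⟨le_rfl, by rw [Set.inter_self]; exact F.nonempty⟩
  le_trans F G H hFG hGH := by
    obtain ⟨hr, x, hxF, hxG⟩ := hFG
    obtain ⟨b, hb, hbH⟩ := exists_upper_mul_mem hGH hxG
    exact ⟨hr.trans hGH.1, x * b, mul_upper_mem hr hxF hb, hbH⟩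
  le_antisymm F G hFG hGF := by
    obtain ⟨hr, x, hxF, hxG⟩ := hFG
    exact eq_of_mem (le_antisymm hr hGF.1) hxF hxG

theorem eq_of_le {F G : CosetFace hγ} (h : F ≤ G) (hr : F.rank = G.rank) : F = G := by
  obtain ⟨-, x, hxF, hxG⟩ := h
  exact eq_of_mem hr hxF hxG

theorem rank_strictMono : StrictMono (rank : CosetFace hγ → ℤ) := fun _ _ h =>
  lt_of_le_of_ne h.le.1 fun hr => h.ne (eq_of_le h.le hr)

theorem lt_of_mem {F G : CosetFace hγ} {x : Γ} (h : F.rank < G.rank) (hF : x ∈ F.carrier)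
    (hG : x ∈ G.carrier) : F < G :=
  lt_of_le_of_ne (le_of_mem h.le hF hG) fun e => h.ne (by rw [e])

theorem mem_carrier_of_rank_eq_neg_one {F : CosetFace hγ} (h : F.rank = -1) (x : Γ) :
    x ∈ F.carrier := by
  obtain ⟨y, hy⟩ := F.nonempty
  rw [mem_iff hy, hγ.faceStabilizer_eq_top (by intro i; omega)]
  trivial

theorem mem_carrier_of_rank_eq {F : CosetFace hγ} (h : F.rank = N) (x : Γ) : x ∈ F.carrier := by
  obtain ⟨y, hy⟩ := F.nonempty
  rw [mem_iff hy, hγ.faceStabilizer_eq_top (by intro i; omega)]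
  trivial

instance : BoundedOrder (CosetFace hγ) where
  bot := mk' hγ 1 (-1) le_rfl (by omega)
  top := mk' hγ 1 N (by omega) le_rfl
  bot_le F := by
    obtain ⟨x, hx⟩ := F.nonempty
    exact le_of_mem F.neg_one_le_rank (mem_carrier_of_rank_eq_neg_one rfl x) hx
  le_top F := by
    obtain ⟨x, hx⟩ := F.nonempty
    exact le_of_mem F.rank_le hx (mem_carrier_of_rank_eq rfl x)

instance [Finite Γ] : Finite (CosetFace hγ) := by
  let f : CosetFace hγ → Set.Icc (-1 : ℤ) N × Set Γ :=
    fun F => (⟨F.rank, F.neg_one_le_rank, F.rank_le⟩, F.carrier)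
  refine Finite.of_injective f fun F G h => ?_
  have h1 := congrArg (fun p => (p.1 : ℤ)) h
  have h2 := congrArg (fun p => p.2) h
  exact CosetFace.ext h1 h2

/-- Any chain of faces has a common element. -/
theorem exists_mem_of_isChain {C : Set (CosetFace hγ)} (hC : IsChain (· ≤ ·) C) :
    ∃ x, ∀ F ∈ C, x ∈ F.carrier := by
  have key : ∀ m : ℕ, ∃ x, ∀ F ∈ C, F.rank + 1 < m → x ∈ F.carrier := by
    intro m
    induction m with
    | zero =>
      refine ⟨1, fun F _ h => ?_⟩
      have := F.neg_one_le_rank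
      omega
    | succ m ih =>
      obtain ⟨x, hx⟩ := ih
      by_cases hF : ∃ F ∈ C, F.rank + 1 = m
      · obtain ⟨F, hFC, hF⟩ := hF
        have huniq : ∀ H ∈ C, H.rank + 1 = m → H = F := by
          intro H hH hr
          rcases hC.total hH hFC with h | h
          · exact eq_of_le h (by omega)
          · exact (eq_of_le h (by omega)).symm
        by_cases hne : ∃ H ∈ C, H.rank + 1 < m
        · have hfin : (rank '' {H | H ∈ C ∧ H.rank + 1 < m}).Finite := by
            refine (Set.finite_Icc (-1 : ℤ) N).subset ?_
            rintro _ ⟨H, -, rfl⟩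
            exact ⟨H.neg_one_le_rank, H.rank_le⟩
          -- With `H` the highest face of `C` below `F`, moving `x` into `F` by generators of index
          -- above the rank of `H` leaves all lower faces of `C` in place.
          obtain ⟨H, ⟨hHC, hHm⟩, hmax⟩ := hfin.exists_maximalFor' rank _ hne
          have hHF : H ≤ F := by
            rcases hC.total hHC hFC with h | h
            · exact h
            · have := h.1
              omega
          obtain ⟨b, hb, hbF⟩ := exists_upper_mul_mem hHF (hx H hHC hHm)
          refine ⟨x * b, fun L hL hLm => ?_⟩
          rcases lt_or_ge (L.rank + 1) m with h | h
          · refine mul_upper_mem ?_ (hx L hL h) hb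
            rcases le_total L.rank H.rank with h' | h'
            · exact h'
            · exact hmax ⟨hL, h⟩ h'
          · rw [huniq L hL (by push_cast at hLm; omega)]
            exact hbF
        · obtain ⟨y, hy⟩ := F.nonempty
          refine ⟨y, fun L hL hLm => ?_⟩
          by_cases h : L.rank + 1 < m
          · exact absurd ⟨L, hL, h⟩ hne
          · rw [huniq L hL (by push_cast at hLm; omega)]
            exact hy
      · refine ⟨x, fun L hL hLm => hx L hL ?_⟩
        have : L.rank + 1 ≠ m := fun h => hF ⟨L, hL, h⟩
        push_cast at hLm
        omega
  obtain ⟨x, hx⟩ := key (N + 2)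
  refine ⟨x, fun F hF => hx F hF ?_⟩
  have := F.rank_le
  push_cast
  omega

/-! ### Flags of sections and their connectedness -/

theorem exists_flag_eq (Φ : Flag (CosetFace hγ)) : ∃ x, ∀ F, F ∈ Φ ↔ x ∈ F.carrier := by
  obtain ⟨x, hx⟩ := exists_mem_of_isChain Φ.chain_le
  refine ⟨x, fun F => ⟨hx F, fun hF => ?_⟩⟩
  rw [Flag.mem_iff_forall_le_or_ge]
  intro G hG
  rcases le_total F.rank G.rank with h | h
  · exact Or.inl (le_of_mem h hF (hx G hG))
  · exact Or.inr (le_of_mem h (hx G hG) hF)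

/-- The flag of a section that consists of the faces through a given element. -/
def sectionFlag {F G : CosetFace hγ} (x : Γ) (hF : x ∈ F.carrier) (hG : x ∈ G.carrier) :
    Flag (Set.Icc F G) where
  carrier := {H | x ∈ H.1.carrier}
  Chain' := by
    intro H hH L hL _
    rcases le_total H.1.rank L.1.rank with h | h
    · exact Or.inl (le_of_mem h hH hL)
    · exact Or.inr (le_of_mem h hL hH)
  max_chain' := by
    intro s hs hxs
    refine hxs.antisymm fun H hH => ?_
    let L : CosetFace hγ := mk' hγ x H.1.rank H.1.neg_one_le_rank H.1.rank_le
    have hL : L ∈ Set.Icc F G := ⟨le_of_mem H.2.1.1 hF mem_mk', le_of_mem H.2.2.1 mem_mk' hG⟩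
    have hxL : x ∈ L.carrier := mem_mk'
    have hLs : (⟨L, hL⟩ : Set.Icc F G) ∈ s := hxs (show x ∈ L.carrier from hxL)
    have : L = H.1 := by
      rcases hs.total hLs hH with h | h
      · exact eq_of_le h rfl
      · exact (eq_of_le (F := H.1) (G := L) h rfl).symm
    change x ∈ H.1.carrier
    rwa [← this]

theorem mem_sectionFlag {F G : CosetFace hγ} {x : Γ} {hF : x ∈ F.carrier} {hG : x ∈ G.carrier}
    {H : Set.Icc F G} : H ∈ sectionFlag x hF hG ↔ x ∈ H.1.carrier := Iff.rfl

theorem exists_eq_sectionFlag {F G : CosetFace hγ} (hFG : F ≤ G) (Φ : Flag (Set.Icc F G)) :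
    ∃ (x : Γ) (hF : x ∈ F.carrier) (hG : x ∈ G.carrier), Φ = sectionFlag x hF hG := by
  have hC : IsChain (· ≤ ·) (Subtype.val '' (Φ : Set (Set.Icc F G))) := by
    rintro _ ⟨H, hH, rfl⟩ _ ⟨L, hL, rfl⟩ _
    exact Φ.le_or_le hH hL
  obtain ⟨x, hx⟩ := exists_mem_of_isChain hC
  have hF : (⟨F, le_rfl, hFG⟩ : Set.Icc F G) ∈ Φ :=
    Flag.mem_iff_forall_le_or_ge.2 fun H _ => Or.inl H.2.1
  have hG : (⟨G, hFG, le_rfl⟩ : Set.Icc F G) ∈ Φ :=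
    Flag.mem_iff_forall_le_or_ge.2 fun H _ => Or.inr H.2.2
  refine ⟨x, hx _ ⟨_, hF, rfl⟩, hx _ ⟨_, hG, rfl⟩, Flag.ext ?_⟩
  exact Φ.max_chain' (sectionFlag x _ _).chain_le fun H hH => hx _ ⟨H, hH, rfl⟩

/-- Right multiplication by `γᵢ` changes at most the face of rank `i`, so a word in the generators
traces a walk in the flag graph. -/
theorem reachable_sectionFlag {F G : CosetFace hγ} {w : Γ}
    (hw : w ∈ Subgroup.closure (γ '' {i | (i : ℤ) ≠ F.rank ∧ (i : ℤ) ≠ G.rank})) :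
    ∀ (x : Γ) (hF : x ∈ F.carrier) (hG : x ∈ G.carrier) (hF' : x * w ∈ F.carrier)
      (hG' : x * w ∈ G.carrier), (flagGraph (fun H : Set.Icc F G => H.1.rank)).Reachable
        (sectionFlag x hF hG) (sectionFlag (x * w) hF' hG') := by
  have hstab : ∀ w ∈ Subgroup.closure (γ '' {i | (i : ℤ) ≠ F.rank ∧ (i : ℤ) ≠ G.rank}),
      w ∈ faceStabilizer γ F.rank ∧ w ∈ faceStabilizer γ G.rank := fun w hw =>
    ⟨closure_image_le_faceStabilizer (fun i hi => hi.1) hw,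
      closure_image_le_faceStabilizer (fun i hi => hi.2) hw⟩
  have hcongr : ∀ (x y : Γ) (hF : x ∈ F.carrier) (hG : x ∈ G.carrier) (hF' : y ∈ F.carrier)
      (hG' : y ∈ G.carrier), x = y → (flagGraph (fun H : Set.Icc F G => H.1.rank)).Reachable
        (sectionFlag x hF hG) (sectionFlag y hF' hG') := by
    rintro x _ _ _ _ _ rfl
    exact SimpleGraph.Reachable.refl _
  induction hw using Subgroup.closure_induction with
  | mem w hw =>
    obtain ⟨i, hi, rfl⟩ := hw
    intro x hF hG hF' hG'
    by_cases h : sectionFlag x hF hG = sectionFlag (x * γ i) hF' hG'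
    · rw [h]
    · refine SimpleGraph.Adj.reachable ⟨i, h, fun H hH => ?_⟩
      rw [mem_sectionFlag, mem_sectionFlag]
      have hmem : γ i ∈ faceStabilizer γ H.1.rank :=
        Subgroup.subset_closure ⟨i, fun e => hH e.symm, rfl⟩
      refine ⟨fun h => mul_mem h hmem, fun h => ?_⟩
      have := mul_mem h hmem
      rwa [mul_assoc, hγ.mul_self, mul_one] at this
  | one =>
    intro x hF hG hF' hG'
    exact hcongr _ _ _ _ _ _ (mul_one x).symm
  | mul w w' hw hw' ih ih' =>
    intro x hF hG hF' hG'
    have h1 := mul_mem hF (hstab w hw).1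
    have h2 := mul_mem hG (hstab w hw).2
    have h3 := mul_mem h1 (hstab w' hw').1
    have h4 := mul_mem h2 (hstab w' hw').2
    exact ((ih x hF hG h1 h2).trans (ih' (x * w) h1 h2 h3 h4)).trans
      (hcongr _ _ _ _ _ _ (mul_assoc x w w'))
  | inv w hw ih =>
    intro x hF hG hF' hG'
    have h : x * w⁻¹ * w = x := inv_mul_cancel_right x w
    exact (hcongr _ _ hF hG (by rwa [h]) (by rwa [h]) h.symm).trans
      (ih (x * w⁻¹) hF' hG' (by rwa [h]) (by rwa [h])).symm

theorem mem_closure_of_mem_inter {F G : CosetFace hγ} {x y : Γ} (hF : x ∈ F.carrier)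
    (hG : x ∈ G.carrier) (hF' : y ∈ F.carrier) (hG' : y ∈ G.carrier) :
    x⁻¹ * y ∈ Subgroup.closure (γ '' {i | (i : ℤ) ≠ F.rank ∧ (i : ℤ) ≠ G.rank}) := by
  have := hγ.inter_eq {i | (i : ℤ) ≠ F.rank} {i | (i : ℤ) ≠ G.rank}
  have h : x⁻¹ * y ∈ Subgroup.closure
      (γ '' ({i | (i : ℤ) ≠ F.rank} ∩ {i | (i : ℤ) ≠ G.rank})) := by
    rw [← this]
    exact ⟨(mem_iff hF).1 hF', (mem_iff hG).1 hG'⟩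
  exact h

theorem sectionFlag_connected {F G : CosetFace hγ} (hFG : F ≤ G) :
    (flagGraph (fun H : Set.Icc F G => H.1.rank)).Connected := by
  obtain ⟨-, x, hF, hG⟩ := id hFG
  have : Nonempty (Flag (Set.Icc F G)) := ⟨sectionFlag x hF hG⟩
  refine ⟨fun Φ Ψ => ?_⟩
  obtain ⟨y, hyF, hyG, rfl⟩ := exists_eq_sectionFlag hFG Φ
  obtain ⟨z, hzF, hzG, rfl⟩ := exists_eq_sectionFlag hFG Ψ
  have h := reachable_sectionFlag (mem_closure_of_mem_inter hyF hyG hzF hzG) y hyF hyG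
  rw [mul_inv_cancel_left] at h
  exact h hzF hzG

/-! ### The diamond condition and regularity -/

theorem rank_covBy {F G : CosetFace hγ} (h : F ⋖ G) : G.rank = F.rank + 1 := by
  by_contra hne
  have hlt := rank_strictMono h.lt
  obtain ⟨-, x, hF, hG⟩ := h.le
  have h1 := F.neg_one_le_rank
  have h2 := G.rank_le
  refine h.2 (c := mk' hγ x (F.rank + 1) (by omega) (by omega)) (lt_of_mem ?_ hF mem_mk')
    (lt_of_mem ?_ mem_mk' hG)
  · exact lt_add_one F.rank
  · change F.rank + 1 < G.rank
    omega

theorem ncard_Ioo {F G : CosetFace hγ} (hFG : F < G) (hr : G.rank = F.rank + 2) :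
    (Set.Ioo F G).ncard = 2 := by
  obtain ⟨-, x, hF, hG⟩ := hFG.le
  have h1 := F.neg_one_le_rank
  have h2 := G.rank_le
  obtain ⟨i, hi⟩ : ∃ i : Fin N, (i : ℤ) = F.rank + 1 :=
    ⟨⟨(F.rank + 1).toNat, by omega⟩, by simp; omega⟩
  let A (y : Γ) : CosetFace hγ := mk' hγ y i (by omega) (by omega)
  have hA : ∀ y, y ∈ F.carrier → y ∈ G.carrier → A y ∈ Set.Ioo F G := fun y hyF hyG =>
    ⟨lt_of_mem (by change F.rank < (i : ℤ); omega) hyF mem_mk',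
      lt_of_mem (by change (i : ℤ) < G.rank; omega) mem_mk' hyG⟩
  have hAi : ∀ y, y ∈ F.carrier → y ∈ G.carrier → A (y * γ i) ∈ Set.Ioo F G := by
    intro y hyF hyG
    refine hA _ (mul_mem hyF (Subgroup.subset_closure ⟨i, ?_, rfl⟩))
      (mul_mem hyG (Subgroup.subset_closure ⟨i, ?_, rfl⟩)) <;> simp only [Set.mem_ofPred_eq] <;> omega
  have hset : Set.Ioo F G = {A x, A (x * γ i)} := by
    refine Set.Subset.antisymm ?_ ?_
    · rintro H ⟨hFH, hHG⟩
      have hr1 := rank_strictMono hFH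
      have hr2 := rank_strictMono hHG
      obtain ⟨-, z, hzF, hzH⟩ := hFH.le
      obtain ⟨b, hb, hbG⟩ := exists_upper_mul_mem hHG.le hzH
      have hbF := mul_upper_mem hr1.le hzF hb
      have hbH := mul_upper_mem le_rfl hzH hb
      have hmem := mem_closure_of_mem_inter hF hG hbF hbG
      -- The word uses neither `i - 1` nor `i + 1`, so `γᵢ` commutes with its other letters. These
      -- stabilize the `i`-face, leaving the cosets of `x` and `x * γ i` only.
      obtain ⟨c, hc, d, hd, hcd⟩ := Subgroup.exists_mul_of_mem_closure_union
        (s := {γ i}) (t := γ '' {l | (l : ℤ) + 1 < i ∨ (i : ℤ) + 1 < l}) (by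
          rintro _ rfl _ ⟨l, hl, rfl⟩
          rcases hl with hl | hl
          · exact (hγ.commute_of_lt (by omega)).symm
          · exact hγ.commute_of_lt (by omega)) (x := x⁻¹ * (z * b)) (by
          rw [← Set.image_singleton, ← Set.image_union]
          refine closure_image_mono ?_ hmem
          rintro l ⟨hl1, hl2⟩
          by_cases hli : l = i
          · exact Or.inl hli
          · have : (l : ℕ) ≠ i := fun h => hli (Fin.ext h)
            refine Or.inr ?_
            change (l : ℤ) + 1 < i ∨ (i : ℤ) + 1 < l
            omega)
      have hd' : d ∈ faceStabilizer γ i :=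
        closure_image_le_faceStabilizer (by
          intro l hl
          change (l : ℤ) + 1 < i ∨ (i : ℤ) + 1 < l at hl
          omega) hd
      have hxc : H = A (x * c) := by
        refine eq_of_mem (x := z * b) (by change H.rank = (i : ℤ); omega) hbH ?_
        have : z * b = x * c * d := by rw [mul_assoc, ← hcd, mul_inv_cancel_left]
        rw [this]
        exact mul_mem mem_mk' hd'
      rcases hγ.mem_closure_singleton hc with rfl | rfl
      · rw [mul_one] at hxc
        exact Or.inl hxc
      · exact Or.inr hxc
    · rintro H (rfl | rfl)
      · exact hA x hF hG
      · exact hAi x hF hG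
  rw [hset, Set.ncard_pair]
  intro h
  have hmem : x * γ i ∈ (A x).carrier := by
    rw [h]
    exact mem_mk'
  rw [mem_iff mem_mk', inv_mul_cancel_left] at hmem
  -- If the two cosets coincided, the intersection condition would put `γ i` in the trivial group.
  have h3 : γ i ∈ Subgroup.closure (γ '' ({i} ∩ {l | (l : ℤ) ≠ i})) := by
    rw [← hγ.inter_eq]
    exact ⟨Subgroup.subset_closure ⟨i, rfl, rfl⟩, hmem⟩
  have h4 : ({i} ∩ {l | (l : ℤ) ≠ i} : Set (Fin N)) = ∅ := by
    ext l
    simp only [Set.mem_inter_iff, Set.mem_singleton_iff, Set.mem_ofPred_eq, Set.mem_empty_iff_false,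
      iff_false, not_and, not_not]
    rintro rfl
    rfl
  rw [h4, Set.image_empty, Subgroup.closure_empty, Subgroup.mem_bot] at h3
  exact hγ.ne_one i h3

/-- Left multiplication as an automorphism. -/
def mulLeft (g : Γ) : CosetFace hγ ≃o CosetFace hγ where
  toFun F := ⟨F.rank, {y | g⁻¹ * y ∈ F.carrier}, F.neg_one_le_rank, F.rank_le, by
    obtain ⟨x, hx⟩ := F.exists_rep
    refine ⟨g * x, ?_⟩
    rw [hx]
    ext y
    simp [mul_assoc]⟩
  invFun F := ⟨F.rank, {y | g * y ∈ F.carrier}, F.neg_one_le_rank, F.rank_le, by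
    obtain ⟨x, hx⟩ := F.exists_rep
    refine ⟨g⁻¹ * x, ?_⟩
    rw [hx]
    ext y
    simp [mul_assoc]⟩
  left_inv F := by
    ext y
    · rfl
    · simp
  right_inv F := by
    ext y
    · rfl
    · simp
  map_rel_iff' := by
    intro F G
    refine and_congr Iff.rfl ⟨?_, ?_⟩
    · rintro ⟨y, h1, h2⟩
      exact ⟨g⁻¹ * y, h1, h2⟩
    · rintro ⟨y, h1, h2⟩
      refine ⟨g * y, ?_, ?_⟩
      · change g⁻¹ * (g * y) ∈ F.carrier
        rwa [inv_mul_cancel_left]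
      · change g⁻¹ * (g * y) ∈ G.carrier
        rwa [inv_mul_cancel_left]

theorem exists_map_flag_eq (Φ Ψ : Flag (CosetFace hγ)) :
    ∃ e : CosetFace hγ ≃o CosetFace hγ, Flag.map e Φ = Ψ := by
  obtain ⟨x, hx⟩ := exists_flag_eq Φ
  obtain ⟨y, hy⟩ := exists_flag_eq Ψ
  refine ⟨mulLeft (y * x⁻¹), Flag.ext ?_⟩
  rw [Flag.coe_map]
  ext F
  constructor
  · rintro ⟨G, hG, rfl⟩
    refine (hy _).2 ?_
    change (y * x⁻¹)⁻¹ * y ∈ G.carrier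
    simpa using (hx G).1 hG
  · intro hF
    refine ⟨(mulLeft (y * x⁻¹)).symm F, (hx _).2 ?_, OrderIso.apply_symm_apply _ _⟩
    change y * x⁻¹ * x ∈ F.carrier
    simpa using (hy F).1 hF

end CosetFace

/-- The regular polytope of a string C-group. -/
def cosetPolytope (hγ : IsStringCGroup γ) : AbstractPolytope.{u} (N : ℤ) where
  Face := CosetFace hγ
  rank := CosetFace.rank
  rank_strictMono := CosetFace.rank_strictMono
  rank_covBy _ _ := CosetFace.rank_covBy
  rank_bot := rfl
  rank_top := rfl
  diamond _ _ := CosetFace.ncard_Ioo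
  strongly_flag_connected _ _ := CosetFace.sectionFlag_connected

theorem cosetPolytope_isRegular (hγ : IsStringCGroup γ) : (cosetPolytope hγ).IsRegular :=
  fun Φ Ψ => CosetFace.exists_map_flag_eq (hγ := hγ) Φ Ψ

end CosetPolytope

/-! ### Ranked flags and the connection group -/

namespace AbstractPolytope

section

variable {n : ℤ} (Q : AbstractPolytope.{u} n)

theorem neg_one_le_rank (F : Q.Face) : -1 ≤ Q.rank F := by
  rw [← Q.rank_bot]
  exact Q.rank_strictMono.monotone bot_le

theorem rank_le (F : Q.Face) : Q.rank F ≤ n :=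
  (Q.rank_strictMono.monotone le_top).trans_eq Q.rank_top

variable {Q}

theorem eq_of_le_of_rank_le {F G : Q.Face} (h : F ≤ G) (hr : Q.rank G ≤ Q.rank F) : F = G := by
  by_contra hne
  exact (Q.rank_strictMono (lt_of_le_of_ne h hne)).not_ge hr

theorem eq_of_total_of_rank_eq {F G : Q.Face} (h : F ≤ G ∨ G ≤ F) (hr : Q.rank F = Q.rank G) :
    F = G := by
  rcases h with h | h
  · exact eq_of_le_of_rank_le h hr.ge
  · exact (eq_of_le_of_rank_le h hr.le).symm

theorem exists_mem_flag_rank_eq [Finite Q.Face] (Φ : Flag Q.Face) {i : ℤ} (h1 : -1 ≤ i) :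
    i ≤ n → ∃ F ∈ Φ, Q.rank F = i := by
  induction i, h1 using Int.leInduction with
  | base => exact fun _ => ⟨⊥, Φ.bot_mem, Q.rank_bot⟩
  | succ i hi ih =>
    intro hin
    obtain ⟨F, hF, hr⟩ := ih (by omega)
    have hmax : ¬ IsMax (⟨F, hF⟩ : Φ) := by
      intro h
      have h2 : (⊤ : Q.Face) ≤ F := h (b := ⟨⊤, Φ.top_mem⟩) (show F ≤ ⊤ from le_top)
      have := Q.rank_strictMono.monotone h2
      rw [Q.rank_top] at this
      omega
    obtain ⟨⟨G, hG⟩, hFG⟩ := exists_covBy_of_wellFoundedLT hmax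
    have hFG' : F < G := hFG.1
    refine ⟨G, hG, ?_⟩
    rw [Q.rank_covBy F G ⟨hFG', fun c hFc hcG => ?_⟩, hr]
    -- A cover within the flag is a cover in `Q`: a face strictly between would be comparable to the
    -- whole flag, hence belong to it by maximality.
    have hc : c ∈ Φ := by
      rw [Flag.mem_iff_forall_le_or_ge]
      intro d hd
      rcases Φ.le_or_le hd hF with h | h
      · exact Or.inr (h.trans hFc.le)
      · rcases Φ.le_or_le hd hG with h' | h'
        · rcases h.eq_or_lt with rfl | h
          · exact Or.inr hFc.le
          · rcases h'.eq_or_lt with rfl | h'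
            · exact Or.inl hcG.le
            · exact absurd (show (⟨d, hd⟩ : Φ) < ⟨G, hG⟩ from h')
                (hFG.2 (show (⟨F, hF⟩ : Φ) < ⟨d, hd⟩ from h))
        · exact Or.inl (hcG.le.trans h')
    exact hFG.2 (show (⟨F, hF⟩ : Φ) < ⟨c, hc⟩ from hFc) (show (⟨c, hc⟩ : Φ) < ⟨G, hG⟩ from hcG)

end

end AbstractPolytope

open AbstractPolytope

/-- A flag, given by its faces of ranks `-1, …, n`; the sequence is extended by constants. -/
@[ext]
structure RankedFlag {N : ℕ} (Q : AbstractPolytope.{u} N) where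
  face : ℤ → Q.Face
  mono : Monotone face
  rank_face : ∀ i, Q.rank (face i) = max (-1) (min i N)

namespace RankedFlag

variable {N : ℕ} {Q : AbstractPolytope.{u} N}

theorem rank_face_of_mem (f : RankedFlag Q) {i : ℤ} (h1 : -1 ≤ i) (h2 : i ≤ N) :
    Q.rank (f.face i) = i := by
  rw [f.rank_face]
  omega

theorem face_of_neg (f : RankedFlag Q) {i : ℤ} (h : i < 0) : f.face i = ⊥ := by
  refine (eq_of_le_of_rank_le bot_le ?_).symm
  rw [f.rank_face, Q.rank_bot]
  omega

theorem face_of_le (f : RankedFlag Q) {i : ℤ} (h : N ≤ i) : f.face i = ⊤ := by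
  refine eq_of_le_of_rank_le le_top ?_
  rw [f.rank_face, Q.rank_top]
  omega

/-- Taking the rank only clamps `i` to `[-1, N]`, and ranked flags are constant beyond both ends. -/
theorem face_rank_face (f g : RankedFlag Q) (i : ℤ) : f.face (Q.rank (g.face i)) = f.face i := by
  rcases lt_or_ge i 0 with h | h
  · rw [g.face_of_neg h, f.face_of_neg h, f.face_of_neg]
    rw [Q.rank_bot]
    omega
  · rcases le_total (N : ℤ) i with h' | h'
    · rw [g.face_of_le h', f.face_of_le h', f.face_of_le Q.rank_top.ge]
    · rw [g.rank_face_of_mem (by omega) h']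

theorem face_lt_face (f : RankedFlag Q) {i j : ℤ} (h1 : -1 ≤ i) (hij : i < j) (h2 : j ≤ N) :
    f.face i < f.face j := by
  refine lt_of_le_of_ne (f.mono hij.le) fun h => ?_
  have := congrArg Q.rank h
  rw [f.rank_face_of_mem h1 (by omega), f.rank_face_of_mem (by omega) h2] at this
  omega

theorem exists_forall_mem_flag [Finite Q.Face] (Φ : Flag Q.Face) :
    ∃ f : RankedFlag Q, ∀ i, f.face i ∈ Φ := by
  have h : ∀ i : ℤ, ∃ F ∈ Φ, Q.rank F = max (-1) (min i N) := fun i =>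
    exists_mem_flag_rank_eq Φ (by omega) (by omega)
  choose F hF hr using h
  refine ⟨⟨F, fun i j hij => ?_, hr⟩, hF⟩
  rcases Φ.le_or_le (hF i) (hF j) with h | h
  · exact h
  · refine (eq_of_le_of_rank_le h ?_).ge
    rw [hr, hr]
    omega

theorem exists_of_isChain [Finite Q.Face] {C : Set Q.Face} (hC : IsChain (· ≤ ·) C) :
    ∃ f : RankedFlag Q, ∀ F ∈ C, f.face (Q.rank F) = F := by
  obtain ⟨Φ, hΦ⟩ := hC.exists_subset_flag
  obtain ⟨f, hf⟩ := exists_forall_mem_flag Φ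
  refine ⟨f, fun F hF => eq_of_total_of_rank_eq (Φ.le_or_le (hf _) (hΦ hF)) ?_⟩
  exact f.rank_face_of_mem (Q.neg_one_le_rank F) (Q.rank_le F)

instance [Finite Q.Face] : Nonempty (RankedFlag Q) := by
  obtain ⟨f, -⟩ := exists_of_isChain (Q := Q) (C := ∅) Set.subsingleton_empty.isChain
  exact ⟨f⟩

instance [Finite Q.Face] : Finite (RankedFlag Q) := by
  refine Finite.of_injective
    (fun (f : RankedFlag Q) (i : Set.Icc (-1 : ℤ) N) => f.face i) fun f g h => ?_
  ext i
  rcases lt_or_ge i 0 with h' | h'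
  · rw [f.face_of_neg h', g.face_of_neg h']
  · rcases le_total (N : ℤ) i with h'' | h''
    · rw [f.face_of_le h'', g.face_of_le h'']
    · exact congrFun h ⟨i, by omega, h''⟩

/-- The flag of all faces of a ranked flag. -/
def toFlag (f : RankedFlag Q) : Flag Q.Face where
  carrier := {F | f.face (Q.rank F) = F}
  Chain' := by
    intro F hF G hG _
    rw [← show f.face (Q.rank F) = F from hF, ← show f.face (Q.rank G) = G from hG]
    exact (le_total (Q.rank F) (Q.rank G)).imp (fun h => f.mono h) fun h => f.mono h
  max_chain' := by
    intro s hs hfs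
    refine hfs.antisymm fun F hF => ?_
    have hr := f.rank_face_of_mem (Q.neg_one_le_rank F) (Q.rank_le F)
    refine eq_of_total_of_rank_eq (hs.total (hfs ?_) hF) hr
    change f.face (Q.rank (f.face (Q.rank F))) = _
    rw [hr]

theorem mem_toFlag {f : RankedFlag Q} {F : Q.Face} : F ∈ f.toFlag ↔ f.face (Q.rank F) = F := Iff.rfl

theorem eq_of_mem_Ioo (f : RankedFlag Q) (i : Fin N) {H L M : Q.Face}
    (hH : H ∈ Set.Ioo (f.face (i - 1)) (f.face (i + 1)))
    (hL : L ∈ Set.Ioo (f.face (i - 1)) (f.face (i + 1)))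
    (hM : M ∈ Set.Ioo (f.face (i - 1)) (f.face (i + 1))) (hLH : L ≠ H) (hMH : M ≠ H) : L = M := by
  have h2 := Q.diamond (f.face (i - 1)) (f.face (i + 1))
    (f.face_lt_face (by omega) (by omega) (by omega)) (by
      rw [f.rank_face_of_mem (by omega) (by omega), f.rank_face_of_mem (by omega) (by omega)]
      ring)
  obtain ⟨A, B, hAB, hset⟩ := Set.ncard_eq_two.1 h2
  rw [hset] at hH hL hM
  rcases hH with rfl | rfl <;> rcases hL with rfl | rfl <;> rcases hM with rfl | rfl <;>
    first | rfl | exact absurd rfl hLH | exact absurd rfl hMH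

theorem face_mem_Ioo (f : RankedFlag Q) (i : Fin N) :
    f.face i ∈ Set.Ioo (f.face (i - 1)) (f.face (i + 1)) :=
  ⟨f.face_lt_face (by omega) (by omega) (by omega), f.face_lt_face (by omega) (by omega) (by omega)⟩

theorem exists_adjacent (f : RankedFlag Q) (i : Fin N) :
    ∃ g : RankedFlag Q, g.face i ≠ f.face i ∧ ∀ j : ℤ, j ≠ i → g.face j = f.face j := by
  have hr1 := f.rank_face_of_mem (i := i - 1) (by omega) (by omega)
  have hr2 := f.rank_face_of_mem (i := i + 1) (by omega) (by omega)
  have h2 := Q.diamond (f.face (i - 1)) (f.face (i + 1))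
    (f.face_lt_face (by omega) (by omega) (by omega)) (by rw [hr1, hr2]; ring)
  obtain ⟨H, hH, hne⟩ := Set.exists_ne_of_one_lt_ncard (by rw [h2]; omega) (f.face i)
  have hrH1 := Q.rank_strictMono hH.1
  have hrH2 := Q.rank_strictMono hH.2
  refine ⟨⟨Function.update f.face i H, fun a b hab => ?_, fun a => ?_⟩, ?_, fun j hj => ?_⟩
  · by_cases ha : a = i
    · subst ha
      by_cases hb : b = i
      · rw [hb]
      · rw [Function.update_self, Function.update_of_ne hb]
        exact hH.2.le.trans (f.mono (by omega))
    · rw [Function.update_of_ne ha]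
      by_cases hb : b = i
      · subst hb
        rw [Function.update_self]
        exact le_trans (f.mono (by omega)) hH.1.le
      · rw [Function.update_of_ne hb]
        exact f.mono hab
  · by_cases ha : a = i
    · subst ha
      rw [Function.update_self]
      omega
    · rw [Function.update_of_ne ha, f.rank_face]
  · simpa using hne
  · exact Function.update_of_ne hj _ _

/-- The `i`-adjacent flag. -/
noncomputable def swap (i : Fin N) (f : RankedFlag Q) : RankedFlag Q := (f.exists_adjacent i).choose

theorem swap_face_ne (i : Fin N) (f : RankedFlag Q) : (swap i f).face i ≠ f.face i :=
  (f.exists_adjacent i).choose_spec.1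

theorem swap_face_of_ne {i : Fin N} (f : RankedFlag Q) {j : ℤ} (h : j ≠ i) :
    (swap i f).face j = f.face j := (f.exists_adjacent i).choose_spec.2 j h

theorem swap_face_mem_Ioo (f : RankedFlag Q) (i : Fin N) :
    (swap i f).face i ∈ Set.Ioo (f.face (i - 1)) (f.face (i + 1)) := by
  have := (swap i f).face_mem_Ioo i
  rwa [swap_face_of_ne f (by omega), swap_face_of_ne f (by omega)] at this

theorem eq_swap_face (f : RankedFlag Q) (i : Fin N) {H : Q.Face}
    (hH : H ∈ Set.Ioo (f.face (i - 1)) (f.face (i + 1))) (hne : H ≠ f.face i) :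
    H = (swap i f).face i :=
  f.eq_of_mem_Ioo i (f.face_mem_Ioo i) hH (f.swap_face_mem_Ioo i) hne (swap_face_ne i f)

theorem swap_involutive (i : Fin N) : Function.Involutive (swap (Q := Q) i) := by
  intro f
  ext j
  by_cases hj : j = i
  · subst hj
    refine ((swap i f).eq_swap_face i ?_ (swap_face_ne i f).symm).symm
    rw [swap_face_of_ne f (by omega), swap_face_of_ne f (by omega)]
    exact f.face_mem_Ioo i
  · rw [swap_face_of_ne _ hj, swap_face_of_ne _ hj]

/-- The new `i`-face depends only on the faces of ranks `i - 1`, `i`, `i + 1`, none of which has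
rank `j`. -/
theorem swap_swap_face {i j : Fin N} (h : (i : ℤ) + 1 < j ∨ (j : ℤ) + 1 < i) (f : RankedFlag Q) :
    (swap i (swap j f)).face i = (swap i f).face i := by
  refine ((swap j f).eq_swap_face i ?_ ?_).symm
  · rw [swap_face_of_ne f (by omega), swap_face_of_ne f (by omega)]
    exact f.swap_face_mem_Ioo i
  · rw [swap_face_of_ne (i := j) f (by omega)]
    exact swap_face_ne i f

theorem swap_comm {i j : Fin N} (h : (i : ℕ) + 1 < j) (f : RankedFlag Q) :
    swap i (swap j f) = swap j (swap i f) := by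
  ext l
  by_cases hi : l = i
  · subst hi
    rw [swap_swap_face (by omega), swap_face_of_ne (swap i f) (by omega)]
  · rw [swap_face_of_ne _ hi]
    by_cases hj : l = j
    · subst hj
      rw [swap_swap_face (by omega)]
    · rw [swap_face_of_ne _ hj, swap_face_of_ne _ hj, swap_face_of_ne _ hi]

/-- The generators of the connection group. -/
noncomputable def swapPerm (Q : AbstractPolytope.{u} N) (i : Fin N) : Equiv.Perm (RankedFlag Q) :=
  (swap_involutive i).toPerm

theorem swapPerm_apply (i : Fin N) (f : RankedFlag Q) : swapPerm Q i f = swap i f := rfl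

theorem swapPerm_mul_self (i : Fin N) : swapPerm Q i * swapPerm Q i = 1 :=
  Equiv.ext fun f => swap_involutive i f

theorem orderOf_swapPerm [Finite Q.Face] (i : Fin N) : orderOf (swapPerm Q i) = 2 := by
  refine orderOf_eq_prime ?_ fun h => ?_
  · rw [pow_two, swapPerm_mul_self]
  · obtain ⟨f⟩ : Nonempty (RankedFlag Q) := inferInstance
    refine swap_face_ne i f ?_
    rw [← swapPerm_apply, h, Equiv.Perm.one_apply]

theorem swapPerm_mul_sq {i j : Fin N} (h : (i : ℕ) + 1 < j) :
    (swapPerm Q i * swapPerm Q j) ^ 2 = 1 := by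
  have hc : Commute (swapPerm Q i) (swapPerm Q j) := Equiv.ext fun f => swap_comm h f
  rw [hc.mul_pow, pow_two, pow_two, swapPerm_mul_self, swapPerm_mul_self, one_mul]

/-! ### Strong flag-connectedness in terms of the connection group -/

theorem closure_apply_face {S : Set (Fin N)} {w : Equiv.Perm (RankedFlag Q)}
    (hw : w ∈ Subgroup.closure (swapPerm Q '' S)) {l : ℤ} (hl : ∀ i ∈ S, (i : ℤ) ≠ l) :
    ∀ f, (w f).face l = f.face l := by
  induction hw using Subgroup.closure_induction with
  | mem w hw =>
    obtain ⟨i, hi, rfl⟩ := hw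
    exact fun f => swap_face_of_ne f (hl i hi).symm
  | one => exact fun f => rfl
  | mul w w' _ _ h h' => exact fun f => (h _).trans (h' f)
  | inv w _ h =>
    intro f
    have := h (w⁻¹ f)
    rwa [Equiv.Perm.coe_inv, Equiv.apply_symm_apply, eq_comm] at this

/-- The faces of ranks `a, …, b` of `f` belong to the flag `χ` of a section. -/
def MemSection (a b : ℤ) {F G : Q.Face} (f : RankedFlag Q) (χ : Flag (Set.Icc F G)) : Prop :=
  ∀ i, a ≤ i → i ≤ b → ∃ h : f.face i ∈ Set.Icc F G, (⟨f.face i, h⟩ : Set.Icc F G) ∈ χ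

theorem exists_memSection (f : RankedFlag Q) {a b : ℤ} {F G : Q.Face} (hF : F ≤ f.face a)
    (hG : f.face b ≤ G) : ∃ χ : Flag (Set.Icc F G), f.MemSection a b χ := by
  have hC : IsChain (· ≤ ·) {H : Set.Icc F G | ∃ i, H.1 = f.face i} := by
    rintro ⟨H, hH⟩ ⟨i, rfl⟩ ⟨L, hL⟩ ⟨j, rfl⟩ _
    exact (le_total i j).imp (fun h => f.mono h) fun h => f.mono h
  obtain ⟨χ, hχ⟩ := hC.exists_subset_flag
  exact ⟨χ, fun i hi hi' => ⟨⟨hF.trans (f.mono hi), (f.mono hi').trans hG⟩, hχ ⟨i, rfl⟩⟩⟩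

/-- The new face `c` of the adjacent section flag has rank `j` strictly between `a` and `b`. By the
diamond condition it is the `j`-face of the swapped flag, so one generator suffices. -/
theorem MemSection.step {a b : ℤ} (ha : -1 ≤ a) (hb : b ≤ N) {F G : Q.Face} (hF : Q.rank F = a)
    (hG : Q.rank G = b) {f : RankedFlag Q} {χ χ' : Flag (Set.Icc F G)} (h : f.MemSection a b χ)
    (hadj : (flagGraph (fun H : Set.Icc F G => Q.rank H)).Adj χ χ') :
    ∃ w ∈ Subgroup.closure (swapPerm Q '' {i | a < (i : ℤ) ∧ (i : ℤ) < b}),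
      (w f).MemSection a b χ' := by
  obtain ⟨j, hne, hj⟩ := hadj
  obtain ⟨c, hc', hc⟩ : ∃ c, c ∈ χ' ∧ c ∉ χ := by
    by_contra hcon
    push Not at hcon
    exact hne (Flag.ext (χ'.max_chain' χ.chain_le fun c hc => hcon c hc)).symm
  have hcj : Q.rank c = j := by
    by_contra hcon
    exact hc ((hj c hcon).2 hc')
  have haj : a ≤ j := by
    rw [← hF, ← hcj]
    exact Q.rank_strictMono.monotone c.2.1
  have hjb : j ≤ b := by
    rw [← hG, ← hcj]
    exact Q.rank_strictMono.monotone c.2.2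
  obtain ⟨hfj, hfjχ⟩ := h j haj hjb
  have hrj := f.rank_face_of_mem (i := j) (by omega) (by omega)
  have hcne : c.1 ≠ f.face j := fun e => hc (by
    have : c = ⟨f.face j, hfj⟩ := Subtype.ext e
    rwa [this])
  have haj' : a < j := by
    refine lt_of_le_of_ne haj fun e => hcne ?_
    rw [← eq_of_le_of_rank_le c.2.1 (by omega), ← eq_of_le_of_rank_le hfj.1 (by omega)]
  have hjb' : j < b := by
    refine lt_of_le_of_ne hjb fun e => hcne ?_
    rw [eq_of_le_of_rank_le c.2.2 (by omega), eq_of_le_of_rank_le hfj.2 (by omega)]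
  obtain ⟨i, hi⟩ : ∃ i : Fin N, (i : ℤ) = j := ⟨⟨j.toNat, by omega⟩, by simp; omega⟩
  have hmem : ∀ l, a ≤ l → l ≤ b → l ≠ j →
      ∃ h : f.face l ∈ Set.Icc F G, (⟨f.face l, h⟩ : Set.Icc F G) ∈ χ' := by
    intro l hl hl' hlj
    obtain ⟨h1, h2⟩ := h l hl hl'
    refine ⟨h1, (hj _ ?_).1 h2⟩
    change Q.rank (f.face l) ≠ j
    rw [f.rank_face_of_mem (by omega) (by omega)]
    exact hlj
  have hcI : c.1 ∈ Set.Ioo (f.face (i - 1)) (f.face (i + 1)) := by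
    have h1 := f.rank_face_of_mem (i := i - 1) (by omega) (by omega)
    have h2 := f.rank_face_of_mem (i := i + 1) (by omega) (by omega)
    obtain ⟨h3, h4⟩ := hmem (i - 1) (by omega) (by omega) (by omega)
    obtain ⟨h5, h6⟩ := hmem (i + 1) (by omega) (by omega) (by omega)
    constructor
    · rcases χ'.le_or_le h4 hc' with h | h
      · exact lt_of_le_of_ne h fun e => by
          have := congrArg Q.rank e
          omega
      · have := Q.rank_strictMono.monotone h
        change Q.rank c.1 ≤ Q.rank (f.face (i - 1)) at this
        omega
    · rcases χ'.le_or_le hc' h6 with h | h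
      · exact lt_of_le_of_ne h fun e => by
          have := congrArg Q.rank e
          omega
      · have := Q.rank_strictMono.monotone h
        change Q.rank (f.face (i + 1)) ≤ Q.rank c.1 at this
        omega
  have hcs := f.eq_swap_face i hcI (by rwa [hi])
  refine ⟨swapPerm Q i, Subgroup.subset_closure ⟨i, ⟨by omega, by omega⟩, rfl⟩, fun l hl hl' => ?_⟩
  rw [swapPerm_apply]
  by_cases hli : l = j
  · rw [hli, ← hi, ← hcs]
    exact ⟨c.2, hc'⟩
  · rw [swap_face_of_ne f (by omega)]
    exact hmem l hl hl' hli

theorem exists_closure_section {f g : RankedFlag Q} {a b : ℤ} (ha : -1 ≤ a) (hab : a ≤ b)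
    (hb : b ≤ N) (hfa : f.face a = g.face a) (hfb : f.face b = g.face b) :
    ∃ w ∈ Subgroup.closure (swapPerm Q '' {i | a < (i : ℤ) ∧ (i : ℤ) < b}),
      ∀ i, a ≤ i → i ≤ b → (w f).face i = g.face i := by
  obtain ⟨χ, hχ⟩ := f.exists_memSection (le_refl (f.face a)) (le_refl (f.face b))
  obtain ⟨χ', hχ'⟩ := g.exists_memSection (a := a) (b := b) hfa.le hfb.ge
  have hF := f.rank_face_of_mem ha (hab.trans hb)
  have hG := f.rank_face_of_mem (ha.trans hab) hb
  have hreach := (Q.strongly_flag_connected _ _ (f.mono hab)).preconnected χ χ'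
  rw [SimpleGraph.reachable_iff_reflTransGen] at hreach
  have key : ∃ w ∈ Subgroup.closure (swapPerm Q '' {i | a < (i : ℤ) ∧ (i : ℤ) < b}),
      (w f).MemSection a b χ' := by
    clear hχ'
    induction hreach with
    | refl => exact ⟨1, one_mem _, hχ⟩
    | tail _ hadj ih =>
      obtain ⟨w, hw, hwf⟩ := ih
      obtain ⟨w', hw', hwf'⟩ := hwf.step ha hb hF hG hadj
      exact ⟨w' * w, mul_mem hw' hw, hwf'⟩
  obtain ⟨w, hw, hwf⟩ := key
  refine ⟨w, hw, fun i hi hi' => ?_⟩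
  obtain ⟨h1, h2⟩ := hwf i hi hi'
  obtain ⟨h3, h4⟩ := hχ' i hi hi'
  exact eq_of_total_of_rank_eq (χ'.le_or_le h2 h4) (by rw [rank_face, rank_face])

/-- Flags that agree at all ranks outside `S` are connected by adjacencies with ranks in `S`. -/
theorem exists_closure_apply_eq (S : Set (Fin N)) {f g : RankedFlag Q}
    (h : ∀ l : ℤ, (∀ i ∈ S, (i : ℤ) ≠ l) → f.face l = g.face l) :
    ∃ w ∈ Subgroup.closure (swapPerm Q '' S), w f = g := by
  classical
  have key : ∀ m : ℕ, ∃ w ∈ Subgroup.closure (swapPerm Q '' S),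
      ∀ l : ℤ, l < m → (w f).face l = g.face l := by
    intro m
    induction m with
    | zero =>
      refine ⟨1, one_mem _, fun l hl => ?_⟩
      push_cast at hl
      rw [face_of_neg _ hl, face_of_neg _ hl]
    | succ m ih =>
      obtain ⟨w, hw, hwl⟩ := ih
      have hoff : ∀ l : ℤ, (∀ i ∈ S, (i : ℤ) ≠ l) → (w f).face l = g.face l := fun l hl =>
        (closure_apply_face hw hl f).trans (h l hl)
      by_cases hmS : ∀ i ∈ S, (i : ℤ) ≠ m
      · refine ⟨w, hw, fun l hl => ?_⟩
        by_cases hlm : l = m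
        · exact hoff l (hlm ▸ hmS)
        · exact hwl l (by push_cast at hl; omega)
      · push Not at hmS
        obtain ⟨i₀, hi₀, him⟩ := hmS
        -- Let `b` end the run of `S` that starts at `m`. The flags agree at ranks `m - 1` and `b`,
        -- so connectedness of that section matches them in between using indices in `S` only.
        have hex : ∃ b : ℕ, m < b ∧ ∀ i ∈ S, (i : ℤ) ≠ b :=
          ⟨N, by omega, fun i _ => by omega⟩
        have hb := Nat.find_spec hex
        have hmin : ∀ i : Fin N, m ≤ (i : ℕ) → (i : ℕ) < Nat.find hex → i ∈ S := by
          intro i hi hib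
          rcases hi.eq_or_lt with e | hlt
          · have : i = i₀ := Fin.ext (by omega)
            rwa [this]
          · have := Nat.find_min hex hib
            push Not at this
            obtain ⟨l, hl, hli⟩ := this hlt
            have : i = l := Fin.ext (by omega)
            rwa [this]
        have hbN : Nat.find hex ≤ N := Nat.find_min' hex ⟨by omega, fun i _ => by omega⟩
        obtain ⟨w', hw', hwl'⟩ := exists_closure_section (f := w f) (g := g) (a := m - 1)
          (b := Nat.find hex) (by omega) (by omega) (by omega) (hwl _ (by omega)) (hoff _ hb.2)
        refine ⟨w' * w, mul_mem (closure_image_mono ?_ hw') hw, fun l hl => ?_⟩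
        · rintro i ⟨h1, h2⟩
          exact hmin i (by omega) (by omega)
        · rw [Equiv.Perm.mul_apply]
          push_cast at hl
          rcases lt_or_ge l (m - 1) with hlt | hge
          · rw [closure_apply_face hw' _, hwl l (by omega)]
            rintro i ⟨h1, h2⟩
            omega
          · exact hwl' l hge (by omega)
  obtain ⟨w, hw, hwl⟩ := key N
  refine ⟨w, hw, RankedFlag.ext (funext fun l => ?_)⟩
  rcases lt_or_ge l N with hl | hl
  · exact hwl l hl
  · rw [face_of_le _ hl, face_of_le _ hl]

/-! ### Regular `k`-faces and freeness -/

/-- The isomorphism `ε` of sections maps the faces of `f` up to rank `k` to those of `g`. -/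
def Corresp (k : ℤ) {F G : Q.Face} (ε : Set.Icc ⊥ F ≃o Set.Icc ⊥ G) (f g : RankedFlag Q) : Prop :=
  f.face k = F ∧ g.face k = G ∧
    ∀ (x : Set.Icc ⊥ F) (i : ℤ), i ≤ k → x.1 = f.face i → (ε x).1 = g.face i

/-- Section isomorphisms preserve the open intervals that define adjacency, so they commute with
swaps below `k`. -/
theorem Corresp.swap {k : ℤ} {F G : Q.Face} {ε : Set.Icc ⊥ F ≃o Set.Icc ⊥ G} {f g : RankedFlag Q}
    (h : Corresp k ε f g) {i : Fin N} (hi : (i : ℤ) < k) : Corresp k ε (swap i f) (swap i g) := by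
  obtain ⟨hF, hG, hε⟩ := h
  refine ⟨?_, ?_, fun x l hl hx => ?_⟩
  · rw [swap_face_of_ne f (by omega), hF]
  · rw [swap_face_of_ne g (by omega), hG]
  · by_cases hli : l = i
    · subst hli
      have hmem : ∀ l, l ≤ k → f.face l ∈ Set.Icc ⊥ F := fun l hl =>
        ⟨bot_le, hF ▸ f.mono hl⟩
      have hI := f.swap_face_mem_Ioo i
      rw [← hx] at hI
      refine g.eq_swap_face i ⟨?_, ?_⟩ fun e => ?_
      · rw [← hε ⟨f.face (i - 1), hmem _ (by omega)⟩ (i - 1) (by omega) rfl]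
        exact ε.strictMono (show (⟨f.face (i - 1), _⟩ : Set.Icc ⊥ F) < x from hI.1)
      · rw [← hε ⟨f.face (i + 1), hmem _ (by omega)⟩ (i + 1) (by omega) rfl]
        exact ε.strictMono (show x < (⟨f.face (i + 1), _⟩ : Set.Icc ⊥ F) from hI.2)
      · rw [← hε ⟨f.face i, hmem _ (by omega)⟩ i (by omega) rfl] at e
        have := congrArg Subtype.val (ε.injective (Subtype.ext e))
        exact swap_face_ne i f (hx.symm.trans this)
    · rw [swap_face_of_ne g hli]
      rw [swap_face_of_ne f hli] at hx
      exact hε x l hl hx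

theorem corresp_closure_iff {k : ℤ} {F G : Q.Face} {ε : Set.Icc ⊥ F ≃o Set.Icc ⊥ G}
    {w : Equiv.Perm (RankedFlag Q)}
    (hw : w ∈ Subgroup.closure (swapPerm Q '' {i | (i : ℤ) < k})) :
    ∀ f g, Corresp k ε (w f) (w g) ↔ Corresp k ε f g := by
  induction hw using Subgroup.closure_induction with
  | mem w hw =>
    obtain ⟨i, hi, rfl⟩ := hw
    intro f g
    refine ⟨fun h => ?_, fun h => h.swap hi⟩
    have := h.swap hi
    rwa [swapPerm_apply, swapPerm_apply, swap_involutive, swap_involutive] at this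
  | one => exact fun f g => Iff.rfl
  | mul w w' _ _ h h' => exact fun f g => (h _ _).trans (h' f g)
  | inv w _ h =>
    intro f g
    have := h (w⁻¹ f) (w⁻¹ g)
    rw [Equiv.Perm.coe_inv, Equiv.apply_symm_apply, Equiv.apply_symm_apply] at this
    exact this.symm

theorem exists_corresp {k : ℤ} (hk1 : -1 ≤ k) (hk2 : k ≤ N) {K : AbstractPolytope.{v} k}
    (hK : K.IsRegular) (hQ : Q.AllFacesIso k K) (f g : RankedFlag Q) :
    ∃ ε : Set.Icc ⊥ (f.face k) ≃o Set.Icc ⊥ (g.face k), Corresp k ε f g := by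
  obtain ⟨α⟩ := hQ (f.face k) (f.rank_face_of_mem hk1 hk2)
  obtain ⟨β⟩ := hQ (g.face k) (g.rank_face_of_mem hk1 hk2)
  obtain ⟨X, hX⟩ := f.exists_memSection (a := -1) (F := ⊥) bot_le (le_refl (f.face k))
  obtain ⟨Y, hY⟩ := g.exists_memSection (a := -1) (F := ⊥) bot_le (le_refl (g.face k))
  obtain ⟨δ, hδ⟩ := hK (Flag.map α X) (Flag.map β Y)
  have hεX : ∀ x ∈ X, (α.trans δ).trans β.symm x ∈ Y := by
    intro x hx
    have h1 : δ (α x) ∈ Flag.map δ (Flag.map α X) := ⟨α x, ⟨x, hx, rfl⟩, rfl⟩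
    rw [hδ] at h1
    obtain ⟨y, hy, hyx⟩ := h1
    have : (α.trans δ).trans β.symm x = y := by
      rw [OrderIso.trans_apply, OrderIso.trans_apply, ← hyx, OrderIso.symm_apply_apply]
    rwa [this]
  refine ⟨(α.trans δ).trans β.symm, rfl, rfl, ?_⟩
  set ε := (α.trans δ).trans β.symm
  have hmem : ∀ i, i ≤ k → f.face i ∈ Set.Icc ⊥ (f.face k) := fun i hi => ⟨bot_le, f.mono hi⟩
  -- `ε` is only an order isomorphism. Ranks strictly increase along the image chain; bounding them
  -- from the bottom up and from the top down forces rank preservation.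
  have hlt : ∀ i (h1 : -1 ≤ i) (h2 : i + 1 ≤ k),
      Q.rank (ε ⟨f.face i, hmem i (by omega)⟩) < Q.rank (ε ⟨f.face (i + 1), hmem _ h2⟩) := by
    intro i h1 h2
    refine Q.rank_strictMono (show (ε _ : Set.Icc ⊥ (g.face k)) < ε _ from ε.strictMono ?_)
    exact f.face_lt_face h1 (lt_add_one i) (h2.trans hk2)
  have hlow : ∀ i (h1 : -1 ≤ i) (h2 : i ≤ k), i ≤ Q.rank (ε ⟨f.face i, hmem i h2⟩) := by
    intro i h1
    induction i, h1 using Int.leInduction with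
    | base => exact fun _ => Q.neg_one_le_rank _
    | succ i h1 ih =>
      intro h2
      have := ih (by omega)
      have := hlt i h1 h2
      omega
  have hupp : ∀ i (h2 : i ≤ k) (h1 : -1 ≤ i), Q.rank (ε ⟨f.face i, hmem i h2⟩) ≤ i := by
    intro i h2
    induction i, h2 using Int.leInductionDown with
    | base =>
      intro h1
      calc Q.rank (ε ⟨f.face k, hmem k le_rfl⟩) ≤ Q.rank (g.face k) :=
            Q.rank_strictMono.monotone (ε _).2.2
        _ = k := g.rank_face_of_mem hk1 hk2
    | pred i h2 ih =>
      intro h1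
      have h3 := ih (by omega)
      have h4 := hlt (i - 1) h1 (by omega)
      simp only [sub_add_cancel] at h4
      omega
  have key : ∀ (x : Set.Icc ⊥ (f.face k)) (i : ℤ), -1 ≤ i → i ≤ k → x.1 = f.face i →
      (ε x).1 = g.face i := by
    rintro ⟨x, hx⟩ i h1 h2 rfl
    obtain ⟨_, h3⟩ := hX i h1 h2
    obtain ⟨_, h4⟩ := hY i h1 h2
    refine eq_of_total_of_rank_eq (Y.le_or_le (hεX _ h3) h4) ?_
    rw [g.rank_face_of_mem h1 (h2.trans hk2)]
    exact le_antisymm (hupp i h2 h1) (hlow i h1 h2)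
  intro x i hi hx
  rcases le_or_gt (-1) i with h | h
  · exact key x i h hi hx
  · have h1 : ∀ f : RankedFlag Q, f.face i = f.face (-1) := fun f => by
      rw [face_of_neg f (by omega), face_of_neg f (by omega)]
    exact (key x (-1) le_rfl hk1 (hx.trans (h1 f))).trans (h1 g).symm

/-- If all `k`-faces are isomorphic to a regular polytope, then the group generated by the first
`k` generators of the connection group acts freely on the flags. -/
theorem eq_one_of_apply_eq {k : ℤ} (hk1 : -1 ≤ k) (hk2 : k ≤ N) {K : AbstractPolytope.{v} k}
    (hK : K.IsRegular) (hQ : Q.AllFacesIso k K) {w : Equiv.Perm (RankedFlag Q)}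
    (hw : w ∈ Subgroup.closure (swapPerm Q '' {i | (i : ℤ) < k})) {f : RankedFlag Q}
    (hf : w f = f) : w = 1 := by
  refine Equiv.ext fun g => RankedFlag.ext (funext fun i => ?_)
  rw [Equiv.Perm.one_apply]
  rcases le_or_gt i k with hi | hi
  · obtain ⟨ε, hε⟩ := exists_corresp hk1 hk2 hK hQ f g
    have h2 := (corresp_closure_iff hw f g).2 hε
    rw [hf] at h2
    have hm : f.face i ∈ Set.Icc ⊥ (f.face k) := ⟨bot_le, f.mono hi⟩
    rw [← h2.2.2 ⟨f.face i, hm⟩ i hi rfl, ← hε.2.2 ⟨f.face i, hm⟩ i hi rfl]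
  · refine closure_apply_face hw ?_ g
    intro l hl
    change (l : ℤ) < k at hl
    omega

/-- For `w` in both spans, `f` and `w f` can differ only at ranks in `I ∩ J`. A word `w'` in those
indices also takes `f` to `w f`, and freeness gives `w = w'`. -/
theorem interCondBelow_swapPerm [Finite Q.Face] {k : ℤ}
    (hfree : ∀ w ∈ Subgroup.closure (swapPerm Q '' {i | (i : ℤ) < k}), ∀ f, w f = f → w = 1) :
    InterCondBelow (swapPerm Q) k.toNat := by
  rintro I J hI hJ w ⟨hwI, hwJ⟩
  obtain ⟨f⟩ : Nonempty (RankedFlag Q) := inferInstance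
  obtain ⟨w', hw', hf⟩ := exists_closure_apply_eq (I ∩ J) (f := f) (g := w f) (by
    intro l hl
    by_cases h : ∀ i ∈ I, (i : ℤ) ≠ l
    · exact (closure_apply_face hwI h f).symm
    · push Not at h
      obtain ⟨i, hi, rfl⟩ := h
      refine (closure_apply_face hwJ (fun j hj hji => ?_) f).symm
      have : j = i := Fin.ext (by omega)
      exact hl i ⟨hi, this ▸ hj⟩ rfl)
  have h1 : w'⁻¹ * w = 1 := by
    refine hfree _ (mul_mem (inv_mem (closure_image_mono ?_ hw')) (closure_image_mono ?_ hwI)) f ?_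
    · intro i hi
      have := hI i hi.1
      change (i : ℤ) < k
      omega
    · intro i hi
      have := hI i hi
      change (i : ℤ) < k
      omega
    · rw [Equiv.Perm.mul_apply, ← hf, Equiv.Perm.coe_inv, Equiv.symm_apply_apply]
  rw [← inv_mul_eq_one.1 h1]
  exact hw'

end RankedFlag

/-! ### The covering of a polytope by a coset polytope -/

namespace CosetFace

open RankedFlag

variable {N : ℕ} {Q : AbstractPolytope.{u} N} {Γ : Type v} [Group Γ] {γ : Fin N → Γ}
  {hγ : IsStringCGroup γ}

/-- The image of the flag of the coset polytope that corresponds to `x`. -/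
def flagAt (φ : Γ →* Equiv.Perm (RankedFlag Q)) (f₀ : RankedFlag Q) (x : Γ) : RankedFlag Q :=
  φ x⁻¹ f₀

/-- The inverse in `flagAt` makes right multiplication by a generator act as the corresponding flag
swap. -/
theorem flagAt_mul (φ : Γ →* Equiv.Perm (RankedFlag Q)) (f₀ : RankedFlag Q) (x w : Γ) :
    flagAt φ f₀ (x * w) = φ w⁻¹ (flagAt φ f₀ x) := by
  rw [flagAt, flagAt, mul_inv_rev, map_mul, Equiv.Perm.mul_apply]

variable {φ : Γ →* Equiv.Perm (RankedFlag Q)}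

theorem map_closure_eq (hφ : ∀ i, φ (γ i) = swapPerm Q i) (S : Set (Fin N)) :
    (Subgroup.closure (γ '' S)).map φ = Subgroup.closure (swapPerm Q '' S) := by
  rw [MonoidHom.map_closure, Set.image_image]
  simp only [hφ]

theorem map_mem_closure (hφ : ∀ i, φ (γ i) = swapPerm Q i) {S : Set (Fin N)} {w : Γ}
    (hw : w ∈ Subgroup.closure (γ '' S)) : φ w ∈ Subgroup.closure (swapPerm Q '' S) := by
  rw [← map_closure_eq hφ]
  exact Subgroup.mem_map_of_mem φ hw

theorem flagAt_mul_face (hφ : ∀ i, φ (γ i) = swapPerm Q i) (f₀ : RankedFlag Q) {S : Set (Fin N)}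
    {x w : Γ} (hw : w ∈ Subgroup.closure (γ '' S)) {l : ℤ} (hl : ∀ i ∈ S, (i : ℤ) ≠ l) :
    (flagAt φ f₀ (x * w)).face l = (flagAt φ f₀ x).face l := by
  rw [flagAt_mul]
  exact closure_apply_face (map_mem_closure hφ (inv_mem hw)) hl _

/-- The covering map. -/
noncomputable def proj (φ : Γ →* Equiv.Perm (RankedFlag Q)) (f₀ : RankedFlag Q)
    (F : CosetFace hγ) : Q.Face :=
  (flagAt φ f₀ F.nonempty.some).face F.rank

theorem proj_eq (hφ : ∀ i, φ (γ i) = swapPerm Q i) (f₀ : RankedFlag Q) {F : CosetFace hγ} {x : Γ}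
    (hx : x ∈ F.carrier) : proj φ f₀ F = (flagAt φ f₀ x).face F.rank := by
  have h : F.nonempty.some⁻¹ * x ∈ faceStabilizer γ F.rank :=
    (mem_iff F.nonempty.some_mem).1 hx
  have := flagAt_mul_face (x := F.nonempty.some) hφ f₀ h (l := F.rank) fun i hi => hi
  rw [mul_inv_cancel_left] at this
  exact this.symm

theorem rank_proj (f₀ : RankedFlag Q) (F : CosetFace hγ) : Q.rank (proj φ f₀ F) = F.rank :=
  (flagAt φ f₀ _).rank_face_of_mem F.neg_one_le_rank F.rank_le

theorem proj_mono (hφ : ∀ i, φ (γ i) = swapPerm Q i) (f₀ : RankedFlag Q) :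
    Monotone (proj (hγ := hγ) φ f₀) := by
  rintro F G ⟨hr, x, hF, hG⟩
  rw [proj_eq hφ f₀ hF, proj_eq hφ f₀ hG]
  exact (flagAt φ f₀ x).mono hr

theorem coe_toFlag_flagAt (hφ : ∀ i, φ (γ i) = swapPerm Q i) (f₀ : RankedFlag Q)
    {Φ : Flag (CosetFace hγ)} {x : Γ} (hx : ∀ F, F ∈ Φ ↔ x ∈ F.carrier) :
    ((flagAt φ f₀ x).toFlag : Set Q.Face) = proj φ f₀ '' (Φ : Set (CosetFace hγ)) := by
  ext F
  constructor
  · intro hF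
    let G : CosetFace hγ := mk' hγ x (Q.rank F) (Q.neg_one_le_rank F) (Q.rank_le F)
    have hxG : x ∈ G.carrier := mem_mk'
    refine ⟨G, (hx G).2 hxG, ?_⟩
    rw [proj_eq hφ f₀ hxG]
    exact hF
  · rintro ⟨G, hG, rfl⟩
    rw [SetLike.mem_coe, mem_toFlag, rank_proj, ← proj_eq hφ f₀ ((hx G).1 hG)]

theorem exists_flagAdjAt (hφ : ∀ i, φ (γ i) = swapPerm Q i) (f₀ : RankedFlag Q) (j : ℤ)
    (Φ Ψ : Flag (CosetFace hγ)) (h : FlagAdjAt rank j Φ Ψ) :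
    ∃ Φ' Ψ' : Flag Q.Face, (Φ' : Set Q.Face) = proj φ f₀ '' (Φ : Set (CosetFace hγ)) ∧
      (Ψ' : Set Q.Face) = proj φ f₀ '' (Ψ : Set (CosetFace hγ)) ∧ FlagAdjAt Q.rank j Φ' Ψ' := by
  obtain ⟨x, hx⟩ := exists_flag_eq Φ
  obtain ⟨y, hy⟩ := exists_flag_eq Ψ
  refine ⟨(flagAt φ f₀ x).toFlag, (flagAt φ f₀ y).toFlag, coe_toFlag_flagAt hφ f₀ hx,
    coe_toFlag_flagAt hφ f₀ hy, ?_⟩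
  have hne : y ≠ x := by
    rintro rfl
    exact h.1 (Flag.ext (Set.ext fun F => (hx F).trans (hy F).symm))
  -- `x` and `y` lie in the same cosets at all ranks except `j`, so the intersection condition
  -- leaves at most the generator `γⱼ`.
  have hw : x⁻¹ * y ∈ Subgroup.closure (γ '' {i | (i : ℤ) = j}) := by
    refine hγ.mem_closure_of_forall_mem _ fun i hi => ?_
    let F : CosetFace hγ := mk' hγ x i (by omega) (by omega)
    have hxF : x ∈ F.carrier := mem_mk'
    exact (mem_iff hxF).1 ((hy F).1 ((h.2 F hi).1 ((hx F).2 hxF)))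
  have hi : ∃ i : Fin N, (i : ℤ) = j := by
    by_contra hcon
    push Not at hcon
    have hempty : {i : Fin N | (i : ℤ) = j} = ∅ := Set.eq_empty_of_forall_notMem hcon
    rw [hempty, Set.image_empty, Subgroup.closure_empty, Subgroup.mem_bot] at hw
    exact hne (inv_mul_eq_one.1 hw).symm
  obtain ⟨i, rfl⟩ := hi
  have hsing : {l : Fin N | (l : ℤ) = i} = {i} := by
    ext l
    exact ⟨fun h => Fin.ext (by exact_mod_cast h), fun h => congrArg (fun a : Fin N => (a : ℤ)) h⟩
  rw [hsing, Set.image_singleton] at hw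
  rcases hγ.mem_closure_singleton hw with h1 | h1
  · exact absurd (inv_mul_eq_one.1 h1).symm hne
  · rw [inv_mul_eq_iff_eq_mul] at h1
    have hyx : flagAt φ f₀ y = swap i (flagAt φ f₀ x) := by
      rw [h1, flagAt_mul, inv_eq_of_mul_eq_one_left (hγ.mul_self i), hφ, swapPerm_apply]
    rw [hyx]
    refine ⟨fun e => ?_, fun F hF => ?_⟩
    · have hr := (swap i (flagAt φ f₀ x)).rank_face_of_mem (i := i) (by omega) (by omega)
      have hm : (swap i (flagAt φ f₀ x)).face i ∈ (swap i (flagAt φ f₀ x)).toFlag := by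
        rw [mem_toFlag, hr]
      rw [← e, mem_toFlag, hr] at hm
      exact swap_face_ne i _ hm.symm
    · rw [mem_toFlag, mem_toFlag, swap_face_of_ne _ hF]

/-! ### The covering restricted to `k`-faces -/

variable {k : ℤ}

theorem exists_lift (hφ : ∀ i, φ (γ i) = swapPerm Q i) {S : Set (Fin N)} {f g : RankedFlag Q}
    (h : ∀ l : ℤ, (∀ i ∈ S, (i : ℤ) ≠ l) → f.face l = g.face l) :
    ∃ w ∈ Subgroup.closure (γ '' S), φ w f = g := by
  obtain ⟨w, hw, hwf⟩ := exists_closure_apply_eq S h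
  rw [← map_closure_eq hφ] at hw
  obtain ⟨v, hv, rfl⟩ := hw
  exact ⟨v, hv, hwf⟩

/-- Flags that have the same faces of rank at least `k` and of rank `i` are connected by the
generators with the remaining ranks. -/
theorem exists_lift_of_face_eq (hφ : ∀ i, φ (γ i) = swapPerm Q i) (hk : k ≤ N) (i : ℤ)
    {f g : RankedFlag Q} (hup : ∀ j, k ≤ j → f.face j = g.face j) (hi : f.face i = g.face i) :
    ∃ w ∈ Subgroup.closure (γ '' {m | (m : ℤ) < k ∧ (m : ℤ) ≠ i}), φ w f = g := by
  refine exists_lift hφ fun l hl => ?_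
  rcases lt_or_ge l k with h | h
  · rcases lt_or_ge l 0 with h0 | h0
    · rw [face_of_neg _ h0, face_of_neg _ h0]
    · by_cases hli : l = i
      · rw [hli, hi]
      · refine absurd ?_ (hl ⟨l.toNat, by omega⟩ ⟨?_, ?_⟩)
        · simp
          omega
        · simp
          omega
        · simp
          omega
  · exact hup l h

/-- Incident images lie in a common flag `e`. Paths to `e` from flags through `H` and through `L`
close up to a loop `v * t * w` at `f` in the first `k` generators. Freeness and injectivity
trivialize the loop, which yields a common element of `H` and `L`. -/
theorem le_of_proj_le [Finite Q.Face] (hφ : ∀ i, φ (γ i) = swapPerm Q i) (f₀ : RankedFlag Q)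
    (hk : k ≤ N)
    (hfree : ∀ w ∈ Subgroup.closure (swapPerm Q '' {i | (i : ℤ) < k}), ∀ f, w f = f → w = 1)
    (hinj : ∀ x ∈ Subgroup.closure (γ '' {i | (i : ℤ) < k}), φ x = 1 → x = 1)
    {F H L : CosetFace hγ} (hF : F.rank = k) (hHF : H ≤ F) (hLF : L ≤ F)
    (h : proj φ f₀ H ≤ proj φ f₀ L) : H ≤ L := by
  have hr : H.rank ≤ L.rank := by
    rw [← rank_proj (φ := φ) f₀ H, ← rank_proj (φ := φ) f₀ L]
    exact Q.rank_strictMono.monotone h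
  have hLk : L.rank ≤ k := hF ▸ hLF.1
  obtain ⟨-, x, hxH, hxF⟩ := id hHF
  obtain ⟨v, hv, hvL⟩ := exists_lower_mul_mem hLF hxF
  rw [hF] at hv
  have hvF := mul_lower_mem hF.ge hxF hv
  set f := flagAt φ f₀ x with hf
  set g := flagAt φ f₀ (x * v) with hg
  have hfg : ∀ j, k ≤ j → g.face j = f.face j := fun j hj =>
    flagAt_mul_face hφ f₀ hv fun i hi => by
      change (i : ℤ) < k at hi
      omega
  rw [proj_eq hφ f₀ hxH, proj_eq hφ f₀ hvL] at h
  have hle : ∀ j, k ≤ j → g.face L.rank ≤ f.face j := fun j hj => by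
    rw [← hfg j hj]
    exact g.mono (hLk.trans hj)
  have hC : IsChain (· ≤ ·) ({f.face H.rank, g.face L.rank} ∪ f.face '' {j | k ≤ j}) := by
    rintro A hA B hB -
    rcases hA with (rfl | rfl) | ⟨a, ha, rfl⟩ <;> rcases hB with (rfl | rfl) | ⟨b, hb, rfl⟩
    · exact Or.inl le_rfl
    · exact Or.inl h
    · exact Or.inl (h.trans (hle b hb))
    · exact Or.inr h
    · exact Or.inl le_rfl
    · exact Or.inl (hle b hb)
    · exact Or.inr (h.trans (hle a ha))
    · exact Or.inr (hle a ha)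
    · exact (le_total a b).imp (fun h => f.mono h) fun h => f.mono h
  obtain ⟨e, he⟩ := exists_of_isChain hC
  have heH : e.face H.rank = f.face H.rank := by
    rw [← face_rank_face e f, he _ (Or.inl (Or.inl rfl))]
  have heL : e.face L.rank = g.face L.rank := by
    rw [← face_rank_face e g, he _ (Or.inl (Or.inr rfl))]
  have heup : ∀ j, k ≤ j → e.face j = f.face j := fun j hj => by
    rw [← face_rank_face e f, he _ (Or.inr ⟨j, hj, rfl⟩)]
  obtain ⟨w, hw, hwf⟩ := exists_lift_of_face_eq hφ hk H.rank (fun j hj => (heup j hj).symm)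
    heH.symm
  obtain ⟨t, ht, hte⟩ := exists_lift_of_face_eq hφ hk L.rank
    (fun j hj => (heup j hj).trans (hfg j hj).symm) heL
  have hlow : v * t * w ∈ Subgroup.closure (γ '' {i | (i : ℤ) < k}) :=
    Subgroup.mul_mem _ (Subgroup.mul_mem _ hv (closure_image_mono (fun i hi => hi.1) ht))
      (closure_image_mono (fun i hi => hi.1) hw)
  have hone : v * t * w = 1 := by
    refine hinj _ hlow (hfree _ (map_mem_closure hφ hlow) f ?_)
    rw [map_mul, map_mul, Equiv.Perm.mul_apply, Equiv.Perm.mul_apply, hwf, hte, hg, flagAt_mul,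
      ← Equiv.Perm.mul_apply, ← map_mul, mul_inv_cancel, map_one, Equiv.Perm.one_apply]
  have hz : x * v * t = x * w⁻¹ := by
    rw [mul_assoc, mul_eq_one_iff_eq_inv.1 hone]
  refine le_of_mem (x := x * w⁻¹) hr ?_ ?_
  · exact mul_mem hxH (inv_mem (closure_image_le_faceStabilizer (fun i hi => hi.2) hw))
  · rw [← hz]
    exact mul_mem hvL (closure_image_le_faceStabilizer (fun i hi => hi.2) ht)

theorem exists_le_proj_eq [Finite Q.Face] (hφ : ∀ i, φ (γ i) = swapPerm Q i) (f₀ : RankedFlag Q)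
    {F : CosetFace hγ} {M : Q.Face} (hM : M ≤ proj φ f₀ F) : ∃ H ≤ F, proj φ f₀ H = M := by
  obtain ⟨x, hx⟩ := F.nonempty
  have hr := Q.rank_strictMono.monotone hM
  rw [rank_proj] at hr
  rw [proj_eq hφ f₀ hx] at hM
  set f := flagAt φ f₀ x with hf
  have hle : ∀ j, F.rank ≤ j → M ≤ f.face j := fun j hj => hM.trans (f.mono hj)
  have hC : IsChain (· ≤ ·) (insert M (f.face '' {j | F.rank ≤ j})) := by
    rintro A hA B hB -
    rcases hA with rfl | ⟨a, ha, rfl⟩ <;> rcases hB with rfl | ⟨b, hb, rfl⟩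
    · exact Or.inl le_rfl
    · exact Or.inl (hle b hb)
    · exact Or.inr (hle a ha)
    · exact (le_total a b).imp (fun h => f.mono h) fun h => f.mono h
  obtain ⟨e, he⟩ := exists_of_isChain hC
  have heup : ∀ j, F.rank ≤ j → f.face j = e.face j := fun j hj => by
    rw [← face_rank_face e f, he _ (Or.inr ⟨j, hj, rfl⟩)]
  -- The second use of `F.rank` is the excluded index, so `w` visibly stabilizes `F`.
  obtain ⟨w, hw, hwf⟩ := exists_lift_of_face_eq hφ F.rank_le F.rank heup (heup _ le_rfl)
  let H : CosetFace hγ := mk' hγ (x * w⁻¹) (Q.rank M) (Q.neg_one_le_rank M) (Q.rank_le M)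
  have hH : x * w⁻¹ ∈ H.carrier := mem_mk'
  refine ⟨H, le_of_mem hr hH (mul_mem hx (inv_mem ?_)), ?_⟩
  · exact closure_image_le_faceStabilizer (fun i hi => hi.2) hw
  · rw [proj_eq hφ f₀ hH, flagAt_mul, inv_inv, ← hf, hwf]
    exact he _ (Or.inl rfl)

theorem nonempty_section_orderIso [Finite Q.Face] (hφ : ∀ i, φ (γ i) = swapPerm Q i)
    (f₀ : RankedFlag Q) (hk : k ≤ N)
    (hfree : ∀ w ∈ Subgroup.closure (swapPerm Q '' {i | (i : ℤ) < k}), ∀ f, w f = f → w = 1)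
    (hinj : ∀ x ∈ Subgroup.closure (γ '' {i | (i : ℤ) < k}), φ x = 1 → x = 1)
    {F : CosetFace hγ} (hF : F.rank = k) :
    Nonempty (Set.Icc ⊥ F ≃o Set.Icc ⊥ (proj φ f₀ F)) := by
  let η : Set.Icc ⊥ F → Set.Icc ⊥ (proj φ f₀ F) := fun H =>
    ⟨proj φ f₀ H.1, bot_le, proj_mono hφ f₀ H.2.2⟩
  let η' : Set.Icc ⊥ F ↪o Set.Icc ⊥ (proj φ f₀ F) := OrderEmbedding.ofMapLEIff η fun H L =>
    ⟨fun h => le_of_proj_le hφ f₀ hk hfree hinj hF H.2.2 L.2.2 h, fun h => proj_mono hφ f₀ h⟩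
  refine ⟨RelIso.ofSurjective η' fun M => ?_⟩
  obtain ⟨H, hH, hHM⟩ := exists_le_proj_eq hφ f₀ M.2.2
  exact ⟨⟨H, bot_le, hH⟩, Subtype.ext hHM⟩

end CosetFace

/-! ### Regular covers -/

namespace AbstractPolytope

open RankedFlag

theorem exists_regular_cover_of_free {N : ℕ} (Q : AbstractPolytope.{u} N) [Finite Q.Face] {k : ℤ}
    (hk1 : -1 ≤ k) (hk2 : k ≤ N)
    (hfree : ∀ w ∈ Subgroup.closure (swapPerm Q '' {i | (i : ℤ) < k}), ∀ f, w f = f → w = 1) :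
    ∃ R : AbstractPolytope.{u} N, Finite R.Face ∧ R.IsRegular ∧ R.Covers Q ∧
      ∀ F : R.Face, R.rank F = k → ∃ F' : Q.Face, Q.rank F' = k ∧
        Nonempty (Set.Icc ⊥ F ≃o Set.Icc ⊥ F') := by
  obtain ⟨Γ, _, _, γ, φ, hγ, hφ, hinj⟩ := exists_isStringCGroup_hom (swapPerm Q) orderOf_swapPerm
    (fun _ _ h => swapPerm_mul_sq h) k.toNat (by omega) (interCondBelow_swapPerm hfree)
  obtain ⟨f₀⟩ : Nonempty (RankedFlag Q) := inferInstance
  have hset : {i : Fin N | (i : ℕ) < k.toNat} = {i : Fin N | (i : ℤ) < k} := by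
    ext i
    change (i : ℕ) < k.toNat ↔ (i : ℤ) < k
    omega
  rw [hset] at hinj
  refine ⟨cosetPolytope hγ, inferInstanceAs (Finite (CosetFace hγ)), cosetPolytope_isRegular hγ,
    ⟨CosetFace.proj φ f₀, CosetFace.proj_mono hφ f₀, CosetFace.rank_proj f₀,
      CosetFace.exists_flagAdjAt hφ f₀⟩, fun F hF => ?_⟩
  exact ⟨CosetFace.proj φ f₀ F, (CosetFace.rank_proj f₀ F).trans hF,
    CosetFace.nonempty_section_orderIso hφ f₀ hk2 hfree hinj hF⟩

theorem exists_regular_cover {N : ℕ} (Q : AbstractPolytope.{u} N) [Finite Q.Face] :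
    ∃ R : AbstractPolytope.{u} N, Finite R.Face ∧ R.IsRegular ∧ R.Covers Q := by
  -- With `k = -1` no generator lies below `k`, so freeness concerns the trivial group.
  obtain ⟨R, h1, h2, h3, -⟩ := Q.exists_regular_cover_of_free (k := -1) le_rfl (by omega) (by
    intro w hw f _
    have hempty : {i : Fin N | (i : ℤ) < -1} = ∅ :=
      Set.eq_empty_of_forall_notMem fun i (hi : (i : ℤ) < -1) => by omega
    rwa [hempty, Set.image_empty, Subgroup.closure_empty, Subgroup.mem_bot] at hw)
  exact ⟨R, h1, h2, h3⟩

theorem exists_regular_cover_of_allFacesIso {N : ℕ} (Q : AbstractPolytope.{u} N) [Finite Q.Face]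
    {k : ℤ} {K : AbstractPolytope.{v} k} (hK : K.IsRegular) (hQ : Q.AllFacesIso k K) :
    ∃ R : AbstractPolytope.{u} N, Finite R.Face ∧ R.IsRegular ∧ R.Covers Q ∧
      R.AllFacesIso k K := by
  by_cases hk : -1 ≤ k ∧ k ≤ N
  · obtain ⟨R, h1, h2, h3, h4⟩ := Q.exists_regular_cover_of_free hk.1 hk.2
      fun w hw f hf => eq_one_of_apply_eq hk.1 hk.2 hK hQ hw hf
    refine ⟨R, h1, h2, h3, fun F hF => ?_⟩
    obtain ⟨F', hF', ⟨e⟩⟩ := h4 F hF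
    obtain ⟨e'⟩ := hQ F' hF'
    exact ⟨e.trans e'⟩
  -- Outside `[-1, N]` there are no `k`-faces, so any regular cover works.
  · obtain ⟨R, h1, h2, h3⟩ := Q.exists_regular_cover
    exact ⟨R, h1, h2, h3, fun F hF =>
      absurd ⟨hF ▸ R.neg_one_le_rank F, hF ▸ R.rank_le F⟩ hk⟩

theorem covers_refl {n : ℤ} (Q : AbstractPolytope.{u} n) : Q.Covers Q :=
  ⟨id, monotone_id, fun _ => rfl, fun _ Φ Ψ h =>
    ⟨Φ, Ψ, (Set.image_id _).symm, (Set.image_id _).symm, h⟩⟩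

theorem isRegular_of_neg {n : ℤ} (hn : n < 0) (Q : AbstractPolytope.{u} n) : Q.IsRegular := by
  have hbot : ∀ F : Q.Face, F = ⊥ := fun F => (eq_of_le_of_rank_le bot_le (by
    have := Q.rank_le F
    rw [Q.rank_bot]
    omega)).symm
  intro Φ Ψ
  refine ⟨OrderIso.refl _, Flag.ext (Set.ext fun F => ?_)⟩
  rw [hbot F]
  exact iff_of_true (Flag.bot_mem _) (Flag.bot_mem _)

end AbstractPolytope

/-- Every finite sggi is covered by a finite string C-group. -/
theorem IsSggi.exists_isStringCGroup_cover {n : ℕ} {G : Type u} [Group G] [Finite G] {g : Fin n → G}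
    (hg : IsSggi g) : ∃ (G' : Type u) (_ : Group G') (_ : Finite G') (g' : Fin n → G'),
      IsStringCGroup g' ∧ SggiCovers g' g := by
  obtain ⟨Γ, _, _, γ, φ, hγ, hφ, -⟩ := exists_isStringCGroup_hom g hg.orderOf_eq_two
    hg.mul_sq_eq_one 0 (Nat.zero_le n) (by
      intro I J hI _
      have : I = ∅ := Set.eq_empty_of_forall_notMem fun i hi => absurd (hI i hi) (Nat.not_lt_zero _)
      simp [this])
  refine ⟨Γ, _, inferInstance, γ, hγ, φ, ?_, hφ⟩
  rw [← MonoidHom.range_eq_top, ← top_le_iff, ← hg.closure_eq_top, Subgroup.closure_le]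
  rintro _ ⟨i, rfl⟩
  exact ⟨γ i, hφ i⟩

theorem theorem3p3 :
    -- (a) every finite sggi is covered by a finite string C-group
    (∀ (n : ℕ) (G : Type u) [Group G] [Finite G] (g : Fin n → G), IsSggi g →
      ∃ (G' : Type u) (_ : Group G') (_ : Finite G') (g' : Fin n → G'),
        IsStringCGroup g' ∧ SggiCovers g' g) ∧
    -- (b) every finite polytope is covered by a finite regular one of the same rank,
    -- which can be chosen with prescribed regular k-faces if the given polytope has them
    (∀ (n : ℤ) (Q : AbstractPolytope.{u} n), Finite Q.Face →
      (∃ R : AbstractPolytope.{u} n, Finite R.Face ∧ R.IsRegular ∧ R.Covers Q) ∧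
      (∀ (k : ℤ) (K : AbstractPolytope.{v} k), K.IsRegular → Q.AllFacesIso k K →
        ∃ R : AbstractPolytope.{u} n, Finite R.Face ∧ R.IsRegular ∧ R.Covers Q ∧
          R.AllFacesIso k K)) := by
  refine ⟨fun n G _ _ g hg => hg.exists_isStringCGroup_cover, fun n Q hQ => ?_⟩
  -- Coset polytopes have rank in `ℕ`. In negative rank `⊥` is the only face, so `Q` is regular and
  -- covers itself.
  rcases lt_or_ge n 0 with hn | hn
  · exact ⟨⟨Q, hQ, Q.isRegular_of_neg hn, Q.covers_refl⟩,
      fun k K _ hK => ⟨Q, hQ, Q.isRegular_of_neg hn, Q.covers_refl, hK⟩⟩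
  · obtain ⟨N, rfl⟩ := Int.eq_ofNat_of_zero_le hn
    exact ⟨Q.exists_regular_cover, fun k K hKr hK => Q.exists_regular_cover_of_allFacesIso hKr hK⟩
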